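/- **Model.** The deterministic Congested Clique has $n$ machines, one per vertex of an $n$-vertex input graph. In each synchronous round every machine performs unbounded local computation and sends one message of $O(\log n)$ bits to every machine. Let $\alpha\ge 0$ be such that $n\times n$ integer matrices with $O(\log n)$-bit entries can be multiplied in $O(n^\alpha)$ rounds in this model, where machine $i$ is given row $i$ of both factors and outputs row $i$ of the product. $\tilde O(f)$ means $O(f\cdot\mathrm{polylog}(n))$. **Objects.** Let $G=(V,E)$ be a connected simple unweighted graph with $V=\{1,\dots,n\}$, $n\ge 1$, and Laplacian $L$; let $S\subseteq V$ and $\overline S=V\setminus S$. $\mathrm{Schur}(G,S)$ is the weighted graph with vertex set $S$ whose Laplacian is $L_{SS}-L_{S\overline S}(L_{\overline S\,\overline S})^{-1}L_{\overline S S}$. Let $T$ be the transition matrix of its random walk (each step uses an incident edge with probability proportional to its weight; a vertex without incident edges has a zero row). Consider the simple random walk on $G$ started at $u$. Let $\mathbf Q[u,v]$ be the probability that it is at $v$ immediately before its first visit to $S$ at a positive time. Let $\deg_S(u)$ be the number of neighbours of $u$ in $S$. Let $R[u,v]=1$ if $u=v$ and $\deg_S(u)=0$; otherwise let $R[u,v]=1/\deg_S(u)$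 if $\{u,v\}\in E$ and $v\in S$; let $R[u,v]=0$ in all other cases. A matrix $A$ approximates $T$ with *subtractive error* at most $\beta$ if $T-\beta\le A\le T$ entrywise. A matrix indexed by $S$ is *computed* if, at the end, the machine of each $u\in S$ holds row $u$ and column $u$ of one such (rational) approximation; at the start the machine of $u\in V$ knows the edges at $u$ and whether $u\in S$. **Statement.** 1. Let $\beta=\Omega(1/n^{c_3})$ with $c_3>0$. Then $T$ can be computed with subtractive error at most $\beta$ in $\tilde O(n^\alpha)$ rounds, by one algorithm for all such $G$ and all $S\subseteq V$. 2. Let moreover $k=O(n^{c_4})$ be a power of $2$, with $c_4>0$. Then also $T^k$ can be computed with subtractive error at most $\beta$ in $\tilde O(n^\alpha)$ rounds, by one algorithm for all such $G$ and $S$. In 1 and 2 the implied constants and the exponent of the logarithm depend only on $\alpha$, on the constants of the matrix multiplication, on $c_3,c_4$ and on the constants implied in the bounds on $\beta$ and $k$. 3. For all such $G$ and $S$ and all $u\in S$ we have $T[u,u]=0$, and for every $v\in S\setminus\{u\}$ $$T[u,v]=M_u\,(\mathbf QR)[u,v],\qquad M_u=\frac{1}{1-(\mathbf QR)[u,u]}.$$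 If $|S|\ge 2$, then $(\mathbf QR)[u,u]<1$ and $M_u\le C n^{c}$, with absolute constants $C,c$. -/

import Mathlib

/-! ### The Congested Clique model -/

/-- A deterministic Congested Clique algorithm for `n` machines, with messages of `B` bits.
Machine `i` starts from its local input; in each round it sends to every machine `j` a `B`-bit
message computed from its local state, and updates its state from the messages it receives.
Local computation is unbounded, hence given by arbitrary functions. -/
structure CliqueAlgorithm (n B : ℕ) (Input Output : Type) where
  /-- the local states of the machines -/
  State : Type
  /-- the initial state of machine `i`, given its local input -/
  init : Fin n → Input → State
  /-- `send i s j` is the message that machine `i`, in state `s`, sends to machine `j` -/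
  send : Fin n → State → Fin n → (Fin B → Bool)
  /-- `update i s m` is the new state of machine `i`, in state `s`, after it has received
  the message `m j` from every machine `j` -/
  update : Fin n → State → (Fin n → (Fin B → Bool)) → State
  /-- the output of machine `i`, computed from its state -/
  output : Fin n → State → Output

namespace CliqueAlgorithm

variable {n B : ℕ} {Input Output : Type}

/-- The states of all machines after `t` rounds. -/
def stateAfter (A : CliqueAlgorithm n B Input Output) (x : Fin n → Input) :
    ℕ → Fin n → A.State
  | 0 => fun i => A.init i (x i)
  | t + 1 => fun i => A.update i (A.stateAfter x t i) (fun j => A.send j (A.stateAfter x t j) i)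

/-- The outputs of all machines after `R` rounds. -/
def run (A : CliqueAlgorithm n B Input Output) (R : ℕ) (x : Fin n → Input) : Fin n → Output :=
  fun i => A.output i (A.stateAfter x R i)

end CliqueAlgorithm

/-- Message length with constant `w`: `w * (⌊log₂ n⌋ + 1)` bits, that is `O(log n)` bits. -/
def messageBits (w n : ℕ) : ℕ := w * (Nat.log 2 n + 1)

/-- `O(n ^ α)` is a running time of `n × n` matrix multiplication in the Congested Clique:
for integer matrices whose entries have `O(log n)` bits (absolute value at most `n ^ c`),
if machine `i` holds the `i`-th row of both factors, then after `O(n ^ α)` rounds with messages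
of `O(log n)` bits machine `i` holds the `i`-th row of the product. -/
def CliqueMatMulTime (α : ℝ) : Prop :=
  ∀ c : ℕ, ∃ (w : ℕ) (C : ℝ), ∀ n : ℕ, 1 ≤ n →
    ∃ (A : CliqueAlgorithm n (messageBits w n) ((Fin n → ℤ) × (Fin n → ℤ)) (Fin n → ℤ)) (R : ℕ),
      (R : ℝ) ≤ C * (n : ℝ) ^ α ∧
      ∀ M N : Matrix (Fin n) (Fin n) ℤ,
        (∀ i j, |M i j| ≤ (n : ℤ) ^ c ∧ |N i j| ≤ (n : ℤ) ^ c) →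
        ∀ i, A.run R (fun i => (M i, N i)) i = (M * N) i

/-! ### Weighted graphs and Schur complements -/

/-- A simple undirected weighted graph: nonnegative symmetric weights without loops;
`u` and `v` are adjacent when `weight u v ≠ 0`. -/
structure SimpleWeightedGraph (V : Type*) where
  /-- the weight of the pair `u`, `v`; zero when it is not an edge -/
  weight : V → V → ℝ
  symm : ∀ u v, weight u v = weight v u
  nonneg : ∀ u v, 0 ≤ weight u v
  loopless : ∀ u, weight u u = 0

namespace SimpleWeightedGraph

variable {V : Type*} [Fintype V] [DecidableEq V]

/-- The Laplacian matrix of a weighted graph. -/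
def laplacian (H : SimpleWeightedGraph V) : Matrix V V ℝ :=
  Matrix.of fun u v => if u = v then ∑ x, H.weight u x else -H.weight u v

/-- The transition matrix of the random walk, which leaves `u` along an edge chosen with
probability proportional to its weight. (The row of a vertex without edges is zero.) -/
noncomputable def transition (H : SimpleWeightedGraph V) : Matrix V V ℝ :=
  Matrix.of fun u v => H.weight u v / ∑ x, H.weight u x

end SimpleWeightedGraph

section Schur

variable {V : Type*} [Fintype V] [DecidableEq V]

/-- The Schur complement `M_SS - M_ST (M_TT)⁻¹ M_TS` of `M` onto `S`, where `T` is the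
complement of `S`. -/
noncomputable def schurComplement (M : Matrix V V ℝ) (S : Finset V) : Matrix S S ℝ :=
  M.toBlock (· ∈ S) (· ∈ S) -
    M.toBlock (· ∈ S) (· ∉ S) * (M.toBlock (· ∉ S) (· ∉ S))⁻¹ * M.toBlock (· ∉ S) (· ∈ S)

theorem inv_nonneg_of_posSemidef_of_offDiag_nonpos {T : Type*} [Fintype T] [DecidableEq T]
    (M : Matrix T T ℝ) (hM : M.PosSemidef) (hoff : ∀ i j, i ≠ j → M i j ≤ 0) (i j : T) :
    0 ≤ M⁻¹ i j := by
  by_cases hdet : IsUnit M.det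
  swap
  · simp [Matrix.nonsing_inv_apply_not_isUnit M hdet]
  let x : T → ℝ := fun a => M⁻¹ a j
  let y : T → ℝ := fun a => max (-x a) 0
  have hMx : M.mulVec x = fun a => (1 : Matrix T T ℝ) a j := by
    rw [← Matrix.mul_nonsing_inv M hdet]; rfl
  have hy0 : ∀ a, 0 ≤ y a := fun a => le_max_right _ _
  have h1 : 0 ≤ y ⬝ᵥ (M.mulVec x) := by
    rw [hMx]
    refine Finset.sum_nonneg fun a _ => mul_nonneg (hy0 a) ?_
    change 0 ≤ (1 : Matrix T T ℝ) a j
    rw [Matrix.one_apply]; split_ifs <;> norm_num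
  have h2 : y ⬝ᵥ (M.mulVec (x + y)) ≤ 0 := by
    refine Finset.sum_nonpos fun a _ => ?_
    rw [Matrix.mulVec, dotProduct, Finset.mul_sum]
    refine Finset.sum_nonpos fun b _ => ?_
    have hxy : ∀ b, 0 ≤ x b + y b := fun b => by
      have := le_max_left (-x b) 0
      change 0 ≤ x b + max (-x b) 0
      linarith
    by_cases hab : a = b
    · subst hab
      have : y a * (x a + y a) = 0 := by
        change max (-x a) 0 * (x a + max (-x a) 0) = 0
        rcases le_total (-x a) 0 with h | h
        · rw [max_eq_right h]; ring
        · rw [max_eq_left h]; ring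
      have h3 : y a * (M a a * (x + y) a) = M a a * (y a * (x a + y a)) := by
        simp only [Pi.add_apply]; ring
      rw [h3, this, mul_zero]
    · exact mul_nonpos_of_nonneg_of_nonpos (hy0 a)
        (mul_nonpos_of_nonpos_of_nonneg (hoff a b hab) (hxy b))
  have h3 : y ⬝ᵥ (M.mulVec y) = 0 := by
    have h4 := hM.dotProduct_mulVec_nonneg y
    rw [Matrix.mulVec_add, dotProduct_add] at h2
    simp only [star_trivial] at h4
    linarith
  have h5 : M.mulVec y = 0 := by
    have := hM.dotProduct_mulVec_zero_iff y
    simp only [star_trivial] at this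
    exact this.1 h3
  have h6 : y = 0 := by
    have : M⁻¹.mulVec (M.mulVec y) = y := by
      rw [Matrix.mulVec_mulVec, Matrix.nonsing_inv_mul M hdet, Matrix.one_mulVec]
    rw [← this, h5, Matrix.mulVec_zero]
  have h7 : max (-x i) 0 = 0 := congrFun h6 i
  have h8 : -x i ≤ 0 := by rw [← h7]; exact le_max_left _ _
  change 0 ≤ x i
  linarith

variable (G : SimpleGraph V) [DecidableRel G.Adj] (S : Finset V)

theorem lapMatrix_offDiag_nonpos (u v : V) (h : u ≠ v) : G.lapMatrix ℝ u v ≤ 0 := by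
  simp only [SimpleGraph.lapMatrix, SimpleGraph.degMatrix, Matrix.sub_apply,
    Matrix.diagonal_apply_ne _ h, SimpleGraph.adjMatrix_apply]
  split_ifs <;> norm_num

theorem schurComplement_lapMatrix_offDiag_nonpos (u v : S) (h : u ≠ v) :
    schurComplement (G.lapMatrix ℝ) S u v ≤ 0 := by
  have hinv := inv_nonneg_of_posSemidef_of_offDiag_nonpos
    ((G.lapMatrix ℝ).toBlock (· ∉ S) (· ∉ S))
    ((SimpleGraph.posSemidef_lapMatrix ℝ G).submatrix _)
    (fun i j hij => lapMatrix_offDiag_nonpos G i j (fun e => hij (Subtype.ext e)))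
  have h1 : G.lapMatrix ℝ u v ≤ 0 := lapMatrix_offDiag_nonpos G u v (fun e => h (Subtype.ext e))
  simp only [schurComplement, Matrix.sub_apply, Matrix.toBlock_apply]
  have h2 : 0 ≤ ((G.lapMatrix ℝ).toBlock (· ∈ S) (· ∉ S) *
      ((G.lapMatrix ℝ).toBlock (· ∉ S) (· ∉ S))⁻¹ *
      (G.lapMatrix ℝ).toBlock (· ∉ S) (· ∈ S)) u v := by
    rw [Matrix.mul_apply]
    refine Finset.sum_nonneg fun b _ => mul_nonneg_of_nonpos_of_nonpos ?_ ?_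
    · rw [Matrix.mul_apply]
      refine Finset.sum_nonpos fun a _ => mul_nonpos_of_nonpos_of_nonneg ?_ (hinv a b)
      exact lapMatrix_offDiag_nonpos G _ _ (fun e => a.2 (e ▸ u.2))
    · exact lapMatrix_offDiag_nonpos G _ _ (fun e => b.2 (e ▸ v.2))
  linarith

theorem schurComplement_lapMatrix_symm (u v : S) :
    schurComplement (G.lapMatrix ℝ) S u v = schurComplement (G.lapMatrix ℝ) S v u := by
  have hL := G.isSymm_lapMatrix (R := ℝ)
  have hb : ∀ p q : V → Prop, ((G.lapMatrix ℝ).toBlock p q).transpose =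
      (G.lapMatrix ℝ).toBlock q p := by
    intro p q
    ext a b
    exact hL.apply _ _
  have : (schurComplement (G.lapMatrix ℝ) S).transpose = schurComplement (G.lapMatrix ℝ) S := by
    simp only [schurComplement, Matrix.transpose_sub, Matrix.transpose_mul,
      Matrix.transpose_nonsing_inv, hb, Matrix.mul_assoc]
  exact (congrFun (congrFun this u) v).symm

/-- The Schur complement graph of `G` onto `S`: the weighted graph with vertex set `S` whose
Laplacian is the Schur complement of the Laplacian of `G` onto `S`
(see `schurGraph_laplacian`). -/
noncomputable def schurGraph : SimpleWeightedGraph S where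
  weight u v := if u = v then 0 else -schurComplement (G.lapMatrix ℝ) S u v
  symm u v := by
    rw [schurComplement_lapMatrix_symm G S u v]
    simp only [eq_comm]
  nonneg u v := by
    split_ifs with h
    · exact le_rfl
    · have := schurComplement_lapMatrix_offDiag_nonpos G S u v h
      linarith
  loopless u := by simp

theorem isUnit_det_lapMatrix_toBlock (hG : G.Connected) (hS : S.Nonempty) :
    IsUnit ((G.lapMatrix ℝ).toBlock (· ∉ S) (· ∉ S)).det := by
  rw [isUnit_iff_ne_zero]
  intro hdet
  obtain ⟨y, hy, hLy⟩ := Matrix.exists_mulVec_eq_zero_iff.2 hdet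
  apply hy
  let z : V → ℝ := fun v => if h : v ∉ S then y ⟨v, h⟩ else 0
  have hz0 : ∀ v ∈ S, z v = 0 := fun v hv => by simp [z, hv]
  have hz1 : ∀ v : {v // v ∉ S}, z v = y v := fun v => by simp [z, v.2]
  have hLz : ∀ v : {v // v ∉ S}, (G.lapMatrix ℝ).mulVec z v = 0 := by
    intro v
    have h0 : ∑ x : {x // x ∈ S}, G.lapMatrix ℝ v x * z x +
        ∑ x : {x // x ∉ S}, G.lapMatrix ℝ v x * z x = ∑ x, G.lapMatrix ℝ v x * z x := by
      convert Fintype.sum_subtype_add_sum_subtype (· ∈ S) (fun x => G.lapMatrix ℝ v x * z x)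
    have h1 : ∑ x : {x // x ∈ S}, G.lapMatrix ℝ v x * z x = 0 :=
      Finset.sum_eq_zero fun x _ => by rw [hz0 x x.2, mul_zero]
    have h2 : ∑ x : {x // x ∉ S}, G.lapMatrix ℝ v x * z x = 0 := by
      simp only [hz1]
      exact congrFun hLy v
    have h3 : ∑ x, G.lapMatrix ℝ v x * z x = 0 := by linarith
    exact h3
  have hq : z ⬝ᵥ (G.lapMatrix ℝ).mulVec z = 0 := by
    refine Finset.sum_eq_zero fun v _ => ?_
    by_cases hv : v ∈ S
    · rw [hz0 v hv, zero_mul]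
    · rw [hLz ⟨v, hv⟩, mul_zero]
  have hLz0 : (G.lapMatrix ℝ).mulVec z = 0 := by
    have := (SimpleGraph.posSemidef_lapMatrix ℝ G).dotProduct_mulVec_zero_iff z
    simp only [star_trivial] at this
    exact this.1 hq
  have hconst := (G.lapMatrix_mulVec_eq_zero_iff_forall_reachable).1 hLz0
  obtain ⟨s, hs⟩ := hS
  funext v
  rw [← hz1 v, hconst v s (hG.preconnected v s), hz0 s hs]
  rfl

theorem schurGraph_laplacian (hG : G.Connected) (hS : S.Nonempty) :
    (schurGraph G S).laplacian = schurComplement (G.lapMatrix ℝ) S := by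
  have hdet := isUnit_det_lapMatrix_toBlock G S hG hS
  have hrow : ∀ v : V, ∑ x : {x // x ∈ S}, G.lapMatrix ℝ v x +
      ∑ x : {x // x ∉ S}, G.lapMatrix ℝ v x = 0 := by
    intro v
    have h0 : ∑ x : {x // x ∈ S}, G.lapMatrix ℝ v x +
        ∑ x : {x // x ∉ S}, G.lapMatrix ℝ v x = ∑ x, G.lapMatrix ℝ v x := by
      convert Fintype.sum_subtype_add_sum_subtype (· ∈ S) (fun x => G.lapMatrix ℝ v x)
    have h1 : ∑ x, G.lapMatrix ℝ v x * 1 = 0 :=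
      congrFun (G.lapMatrix_mulVec_const_eq_zero (R := ℝ)) v
    simp only [mul_one] at h1
    linarith
  have hone : ∀ p : V → Prop, ∀ [DecidablePred p],
      (((G.lapMatrix ℝ).toBlock p (· ∈ S)).mulVec fun _ => 1) =
      -((G.lapMatrix ℝ).toBlock p (· ∉ S)).mulVec fun _ => 1 := by
    intro p _
    funext v
    have := hrow v
    simp only [Matrix.mulVec, dotProduct, Matrix.toBlock_apply, mul_one, Pi.neg_apply]
    linarith
  have hsum : (schurComplement (G.lapMatrix ℝ) S).mulVec (fun _ => 1) = 0 := by
    rw [schurComplement, Matrix.sub_mulVec, ← Matrix.mulVec_mulVec, hone (· ∉ S),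
      Matrix.mulVec_neg, Matrix.mulVec_mulVec, Matrix.mul_assoc,
      Matrix.nonsing_inv_mul _ hdet, Matrix.mul_one, hone (· ∈ S)]
    simp
  ext u v
  by_cases huv : u = v
  · subst huv
    have h1 := congrFun hsum u
    simp only [Matrix.mulVec, dotProduct, mul_one, Pi.zero_apply] at h1
    rw [Fintype.sum_eq_add_sum_compl u] at h1
    simp only [SimpleWeightedGraph.laplacian, schurGraph, Matrix.of_apply, if_true]
    rw [Fintype.sum_eq_add_sum_compl u, if_pos rfl, zero_add]
    have h2 : ∀ x ∈ ({u}ᶜ : Finset S), (if u = x then 0 else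
        -schurComplement (G.lapMatrix ℝ) S u x) = -schurComplement (G.lapMatrix ℝ) S u x := by
      intro x hx
      rw [if_neg]
      rintro rfl
      simp at hx
    rw [Finset.sum_congr rfl h2, Finset.sum_neg_distrib]
    linarith
  · simp [SimpleWeightedGraph.laplacian, schurGraph, huv]

end Schur

/-! ### The shortcut graph and the step matrix -/

section Shortcut

variable {V : Type*} [Fintype V] [DecidableEq V]
variable (G : SimpleGraph V) [DecidableRel G.Adj] (S : Finset V)

/-- The transition matrix of the simple random walk on `G`: every neighbour is equally likely. -/
noncomputable def walkMatrix : Matrix V V ℝ :=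
  Matrix.of fun u v => if G.Adj u v then 1 / (G.degree u : ℝ) else 0

open Classical in
/-- The probability that the first `m` steps `x 0 = u, x 1, …, x m` of the random walk on `G`
started at `u` satisfy `E`. -/
noncomputable def walkProb (u : V) (m : ℕ) (E : (Fin (m + 1) → V) → Prop) : ℝ :=
  ∑ x : Fin (m + 1) → V,
    if x 0 = u ∧ E x then ∏ i : Fin m, walkMatrix G (x i.castSucc) (x i.succ) else 0

/-- The transition matrix `Q` of the shortcut graph: `Q u v` is the probability that the random
walk on `G` started at `u` is at `v` just before its first visit to `S` at a positive time.
The event is split according to the time `j + 1` of that visit. -/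
noncomputable def shortcutMatrix : Matrix V V ℝ :=
  Matrix.of fun u v => ∑' j : ℕ, walkProb G u (j + 1) fun x =>
    (∀ i : Fin (j + 2), 0 < i.val → i.val < j + 1 → x i ∉ S) ∧
      x (Fin.last (j + 1)) ∈ S ∧ x (Fin.last j).castSucc = v

/-- The number of neighbours of `u` in `S`. -/
def degreeIn (u : V) : ℕ := (G.neighborFinset u ∩ S).card

/-- The transition matrix of a single step into `S`: from `u` to a uniformly chosen neighbour
in `S`, or to `u` itself if `u` has no neighbour in `S`. -/
noncomputable def stepMatrix : Matrix V V ℝ :=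
  Matrix.of fun u v =>
    if u = v ∧ degreeIn G S u = 0 then 1
    else if G.Adj u v ∧ v ∈ S then 1 / (degreeIn G S u : ℝ)
    else 0

/-- The factor `1 / (1 - (Q R) u u)` by which row `u` of `Q R` is renormalized. -/
noncomputable def rowFactor (u : V) : ℝ :=
  1 / (1 - (shortcutMatrix G S * stepMatrix G S) u u)

end Shortcut

/-! ### Computing matrices indexed by a vertex set -/

/-- What a machine knows initially about the graph and the vertex set: the edges at the vertex
that it hosts (given by their other endpoints), and whether that vertex belongs to the set. -/
structure LocalInput (n : ℕ) where
  /-- the neighbours of the hosted vertex -/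
  neighbors : Set (Fin n)
  /-- whether the hosted vertex belongs to the vertex set -/
  marked : Prop

/-- The local inputs of the machines, for the graph `G` and the vertex set `S`. -/
def localInput {n : ℕ} (G : SimpleGraph (Fin n)) (S : Finset (Fin n)) (i : Fin n) :
    LocalInput n where
  neighbors := G.neighborSet i
  marked := i ∈ S

/-- The outputs `out`, a row and a column for each machine, represent the `S × S` matrix `T` with
subtractive error at most `β`: they are the rows and columns, held by the machines that host
the vertices of `S`, of a rational matrix `A` with `T - β ≤ A ≤ T` entrywise. -/
def HoldsWithSubtractiveError {n : ℕ} {S : Finset (Fin n)}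
    (out : Fin n → (Fin n → ℚ) × (Fin n → ℚ)) (T : Matrix S S ℝ) (β : ℝ) : Prop :=
  ∃ A : Matrix S S ℚ,
    (∀ u v, (A u v : ℝ) ≤ T u v ∧ T u v - β ≤ (A u v : ℝ)) ∧
    ∀ u v : S, (out u).1 v = A u v ∧ (out v).2 u = A u v

/-- On `n` machines, with messages of `B` bits and within `R` rounds, the `k`-th power of the
transition matrix of the Schur complement graph of `G` onto `S` can be computed with subtractive
error at most `β`, by one algorithm for all connected graphs `G` and vertex sets `S`. -/
def CliqueComputesSchurPow (n B R k : ℕ) (β : ℝ) : Prop :=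
  ∃ A : CliqueAlgorithm n B (LocalInput n) ((Fin n → ℚ) × (Fin n → ℚ)),
    ∀ (G : SimpleGraph (Fin n)) [DecidableRel G.Adj], G.Connected → ∀ S : Finset (Fin n),
      HoldsWithSubtractiveError (A.run R (localInput G S)) ((schurGraph G S).transition ^ k) β

/-! Let `W` be the walk matrix, `D` the degrees, `H` the hitting distribution on `S`
(`harmonicMatrix`) and `F = W H` the law of the first return to `S` (`returnMatrix`). Since `L = D
(1 - W)` and `L H` vanishes outside `S`, the Schur complement is `D (1 - F)` on `S`
(`schurComplement_eq`). Dropping the loops leaves `T u v = F u v / (1 - F u u)` off the diagonal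
(`schurGraph_transition_apply`). Splitting a walk at the last vertex before its return to `S` gives
`F = Q R` on the columns in `S` (`shortcutMatrix_mul_stepMatrix`), hence the factorization.

The quantitative input is that hitting times are at most `n ^ 4`, by an energy argument
(`exists_hittingTime`). This bounds `1 - F u u` from below by `1 / (n ^ 4 + 1)`, and it shows that
the walk stopped in `S` is absorbed within polynomially many steps up to a small error.

The algorithm needs no approximation of `Q`. It squares the matrix of the stopped walk `O(log n)`
times to approximate `H`, multiplies once by `W`, removes the diagonal and rescales each row locally
to get `T`, and squares `log₂ k` more times. Entries are kept as integers over a common denominator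
`N`, a power of `n`, and are always rounded down. For nonnegative matrices with row sums at most one
this preserves lower bounds, and errors of row sums merely add up in a product
(`IsLowerApprox.roundMul`). Logarithmically many doublings of the error cost a polynomial factor,
which a large `N` absorbs. One final round turns rows into columns. -/

/-! ### Composing Congested Clique algorithms. -/

/-- Within `R` rounds and with messages of `B` bits, some algorithm maps the local inputs `x` to
the local outputs `f x`, for all inputs `x` in `D`. -/
def CliqueComputes {n : ℕ} {I O : Type} (B R : ℕ) (D : Set (Fin n → I))
    (f : (Fin n → I) → Fin n → O) : Prop :=
  ∃ A : CliqueAlgorithm n B I O, ∀ x ∈ D, A.run R x = f x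

namespace CliqueComputes

variable {n B B' R R' : ℕ} {I O X Y : Type}

theorem congr {D D' : Set (Fin n → I)} {f g : (Fin n → I) → Fin n → O}
    (h : CliqueComputes B R D f) (hD : D' ⊆ D) (hfg : ∀ x ∈ D', f x = g x) :
    CliqueComputes B R D' g := by
  obtain ⟨A, hA⟩ := h
  exact ⟨A, fun x hx => (hA x (hD hx)).trans (hfg x hx)⟩

theorem localMap (g : Fin n → I → O) :
    CliqueComputes B 0 Set.univ (fun (x : Fin n → I) i => g i (x i)) :=
  ⟨{ State := I
     init := fun _ x => x
     send := fun _ _ _ _ => false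
     update := fun _ s _ => s
     output := g }, fun _ _ => rfl⟩

/-- Longer messages can be used. -/
theorem mono_bits {D : Set (Fin n → I)} {f : (Fin n → I) → Fin n → O}
    (h : CliqueComputes B R D f) (hB : B ≤ B') : CliqueComputes B' R D f := by
  obtain ⟨A, hA⟩ := h
  let A' : CliqueAlgorithm n B' I O :=
    { State := A.State
      init := A.init
      send := fun i s j b => if hb : b.val < B then A.send i s j ⟨b, hb⟩ else false
      update := fun i s m => A.update i s (fun j b => m j (Fin.castLE hB b))
      output := A.output }
  refine ⟨A', fun x hx => ?_⟩
  rw [← hA x hx]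
  have hst : ∀ t, A'.stateAfter x t = A.stateAfter x t := by
    intro t
    induction t with
    | zero => rfl
    | succ t ih =>
      funext i
      change A.update i (A'.stateAfter x t i) _ = A.update i (A.stateAfter x t i) _
      rw [ih]
      congr 1
      funext j b
      simp [A', Fin.castLE]
  funext i
  change A.output i (A'.stateAfter x R i) = _
  rw [hst]
  rfl

/-- Local preprocessing and postprocessing, where the postprocessing still has access to the
original input. -/
theorem prePost {D : Set (Fin n → I)} {f : (Fin n → I) → Fin n → O}
    (h : CliqueComputes B R D f) (pre : Fin n → X → I) (post : Fin n → X → O → Y) :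
    CliqueComputes B R {x | (fun i => pre i (x i)) ∈ D}
      (fun x i => post i (x i) (f (fun i => pre i (x i)) i)) := by
  obtain ⟨A, hA⟩ := h
  let A' : CliqueAlgorithm n B X Y :=
    { State := X × A.State
      init := fun i x => (x, A.init i (pre i x))
      send := fun i s j => A.send i s.2 j
      update := fun i s m => (s.1, A.update i s.2 m)
      output := fun i s => post i s.1 (A.output i s.2) }
  refine ⟨A', fun x hx => ?_⟩
  have hst : ∀ t, A'.stateAfter x t =
      fun i => (x i, A.stateAfter (fun i => pre i (x i)) t i) := by
    intro t
    induction t with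
    | zero => rfl
    | succ t ih =>
      funext i
      simp only [CliqueAlgorithm.stateAfter, ih, A']
  funext i
  change post i (A'.stateAfter x R i).1 (A.output i (A'.stateAfter x R i).2) = _
  have hf := congrFun (hA _ hx) i
  rw [hst]
  exact congrArg (post i (x i)) hf

/-- Running one algorithm after another. -/
theorem comp {D : Set (Fin n → I)} {E : Set (Fin n → O)} {f : (Fin n → I) → Fin n → O}
    {g : (Fin n → O) → Fin n → Y} (hg : CliqueComputes B R' E g) (hf : CliqueComputes B R D f)
    (hm : Set.MapsTo f D E) : CliqueComputes B (R + R') D (fun x => g (f x)) := by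
  obtain ⟨A, hA⟩ := hf
  obtain ⟨A₂, hA₂⟩ := hg
  -- The left summand carries a round counter. At count `R` the output of the first algorithm
  -- becomes the input of the second without spending a round; for `R = 0` this happens already in
  -- `init`. After `R + R'` rounds the state is always in the right summand, so the other branch of
  -- `output` is a filler.
  let next : Fin n → A.State → ℕ → (A.State × ℕ) ⊕ A₂.State := fun i s t =>
    if t = R then Sum.inr (A₂.init i (A.output i s)) else Sum.inl (s, t)
  let A' : CliqueAlgorithm n B I Y :=
    { State := (A.State × ℕ) ⊕ A₂.State
      init := fun i x => next i (A.init i x) 0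
      send := fun i s j => match s with
        | Sum.inl s => A.send i s.1 j
        | Sum.inr s => A₂.send i s j
      update := fun i s m => match s with
        | Sum.inl s => next i (A.update i s.1 m) (s.2 + 1)
        | Sum.inr s => Sum.inr (A₂.update i s m)
      output := fun i s => match s with
        | Sum.inl s => A₂.output i (A₂.init i (A.output i s.1))
        | Sum.inr s => A₂.output i s }
  refine ⟨A', fun x hx => ?_⟩
  have h1 : ∀ t, t ≤ R → A'.stateAfter x t = fun i => next i (A.stateAfter x t i) t := by
    intro t
    induction t with
    | zero => intro _; rfl
    | succ t ih =>
      intro ht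
      have hne : t ≠ R := by omega
      funext i
      simp only [CliqueAlgorithm.stateAfter, ih (by omega), A', next, if_neg hne]
  have h2 : ∀ t, A'.stateAfter x (R + t) = fun i => Sum.inr (A₂.stateAfter (f x) t i) := by
    intro t
    induction t with
    | zero =>
      rw [Nat.add_zero, h1 R le_rfl]
      funext i
      simp only [next, if_true, ← hA x hx]
      rfl
    | succ t ih =>
      funext i
      rw [← Nat.add_assoc]
      simp only [CliqueAlgorithm.stateAfter, ih, A']
  refine Eq.trans ?_ (hA₂ _ (hm hx))
  funext i
  simp only [CliqueAlgorithm.run, h2, A']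

theorem iterate {D : Set (Fin n → I)} {f : (Fin n → I) → Fin n → I}
    (hf : CliqueComputes B R D f) (hm : Set.MapsTo f D D) (t : ℕ) :
    CliqueComputes B (t * R) D f^[t] := by
  induction t with
  | zero =>
    rw [Nat.zero_mul]
    exact (localMap fun _ x => x).congr (Set.subset_univ _) (fun _ _ => rfl)
  | succ t ih =>
    rw [Nat.succ_mul, Nat.add_comm]
    exact ih.comp hf hm

/-- In one round, bounded integers can be sent to all machines. -/
theorem transpose (m : ℤ) (hm : m < 2 ^ B) :
    CliqueComputes B 1 {x : Fin n → Fin n → ℤ | ∀ i j, 0 ≤ x i j ∧ x i j ≤ m}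
      (fun x i => (x i, fun j => x j i)) := by
  let e : (Fin B → Bool) ≃ Fin (2 ^ B) := Fintype.equivFinOfCardEq (by simp)
  let A : CliqueAlgorithm n B (Fin n → ℤ) ((Fin n → ℤ) × (Fin n → ℤ)) :=
    { State := (Fin n → ℤ) × (Fin n → ℤ)
      init := fun _ x => (x, fun _ => 0)
      -- `Fin.ofNat` reduces modulo `2 ^ B` and `toNat` truncates at zero; both are harmless for
      -- entries in `[0, m]` with `m < 2 ^ B`.
      send := fun _ s j => e.symm (Fin.ofNat _ (s.1 j).toNat)
      update := fun _ s msg => (s.1, fun j => ((e (msg j)).val : ℤ))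
      output := fun _ s => s }
  refine ⟨A, fun x hx => ?_⟩
  funext i
  simp only [CliqueAlgorithm.run, CliqueAlgorithm.stateAfter, A, Equiv.apply_symm_apply]
  refine Prod.ext rfl (funext fun j => ?_)
  obtain ⟨h0, h1⟩ := hx j i
  have h2 : (x j i).toNat < 2 ^ B := by
    zify
    rw [Int.toNat_of_nonneg h0]
    omega
  simp only [Fin.ofNat, Nat.mod_eq_of_lt h2, Int.toNat_of_nonneg h0]

end CliqueComputes

theorem CliqueMatMulTime.cliqueComputes {α : ℝ} (h : CliqueMatMulTime α) (c : ℕ) :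
    ∃ (w : ℕ) (C : ℝ), ∀ n : ℕ, 1 ≤ n → ∃ R : ℕ, (R : ℝ) ≤ C * (n : ℝ) ^ α ∧
      CliqueComputes (messageBits w n) R
        {x : Fin n → (Fin n → ℤ) × (Fin n → ℤ) |
          ∀ i j, |(x i).1 j| ≤ (n : ℤ) ^ c ∧ |(x i).2 j| ≤ (n : ℤ) ^ c}
        (fun x i => (Matrix.of (fun i => (x i).1) * Matrix.of (fun i => (x i).2) :
          Matrix (Fin n) (Fin n) ℤ) i) := by
  obtain ⟨w, C, hwC⟩ := h c
  refine ⟨w, C, fun n hn => ?_⟩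
  obtain ⟨A, R, hR, hA⟩ := hwC n hn
  exact ⟨R, hR, A, fun x hx => funext fun i => hA _ _ hx i⟩

/-! ### Fixed-point arithmetic with rounding down. -/

/-- The product of two integer matrices, divided by `N` and rounded down. -/
def roundMul {ι κ τ : Type*} [Fintype κ] (N : ℤ) (Y : Matrix ι κ ℤ) (Z : Matrix κ τ ℤ) :
    Matrix ι τ ℤ :=
  Matrix.of fun i j => (Y * Z) i j / N

/-- Nonnegative entries and row sums at most `N`. -/
structure RowBounded {ι κ : Type*} [Fintype κ] (N : ℤ) (Z : Matrix ι κ ℤ) : Prop where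
  nonneg : ∀ i j, 0 ≤ Z i j
  sum_le : ∀ i, ∑ j, Z i j ≤ N

/-- The integer matrix `Z` approximates `N • M` from below, with error at most `Δ` in the sum of
each row. -/
structure IsLowerApprox {ι κ : Type*} [Fintype κ] (N : ℤ) (Z : Matrix ι κ ℤ) (M : Matrix ι κ ℝ)
    (Δ : ℝ) : Prop where
  nonneg : ∀ i j, 0 ≤ Z i j
  le : ∀ i j, (Z i j : ℝ) ≤ N * M i j
  sum_le : ∀ i, ∑ j, (N * M i j - Z i j) ≤ Δ

section Rounding

variable {ι κ τ : Type*} [Fintype κ] [Fintype τ] {N : ℤ}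

theorem RowBounded.le {Z : Matrix ι κ ℤ} (h : RowBounded N Z) (i : ι) (j : κ) : Z i j ≤ N :=
  (Finset.single_le_sum (fun j _ => h.nonneg i j) (Finset.mem_univ j)).trans (h.sum_le i)

theorem RowBounded.abs_le {Z : Matrix ι κ ℤ} (h : RowBounded N Z) (i : ι) (j : κ) :
    |Z i j| ≤ N := by
  rw [abs_of_nonneg (h.nonneg i j)]
  exact h.le i j

/-- This invariant keeps all factors within the entry bound required for fast multiplication. Before
the division the row sums are at most `N * N`, and rounding down only decreases them. -/
theorem RowBounded.roundMul (hN : 0 < N) {Y : Matrix ι κ ℤ} {Z : Matrix κ τ ℤ}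
    (hY : RowBounded N Y) (hZ : RowBounded N Z) : RowBounded N (roundMul N Y Z) where
  nonneg i j := Int.ediv_nonneg
    (Finset.sum_nonneg fun k _ => mul_nonneg (hY.nonneg i k) (hZ.nonneg k j)) hN.le
  sum_le i := by
    have h1 : (∑ j, _root_.roundMul N Y Z i j) * N ≤ N * N := by
      rw [Finset.sum_mul]
      calc ∑ j, _root_.roundMul N Y Z i j * N ≤ ∑ j, ∑ k, Y i k * Z k j :=
            Finset.sum_le_sum fun j _ => Int.ediv_mul_le _ hN.ne'
        _ = ∑ k, Y i k * ∑ j, Z k j := by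
            rw [Finset.sum_comm]
            simp only [Finset.mul_sum]
        _ ≤ ∑ k, Y i k * N :=
            Finset.sum_le_sum fun k _ => mul_le_mul_of_nonneg_left (hZ.sum_le k) (hY.nonneg i k)
        _ ≤ N * N := by
            rw [← Finset.sum_mul]
            exact mul_le_mul_of_nonneg_right (hY.sum_le i) hN.le
    exact le_of_mul_le_mul_right h1 hN

theorem Int.cast_ediv_le (a b : ℤ) (hb : 0 < b) : ((a / b : ℤ) : ℝ) ≤ (a : ℝ) / b := by
  rw [le_div_iff₀ (by exact_mod_cast hb)]
  exact_mod_cast Int.ediv_mul_le a hb.ne'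

theorem Int.div_sub_one_le_cast_ediv (a b : ℤ) (hb : 0 < b) :
    (a : ℝ) / b - 1 ≤ ((a / b : ℤ) : ℝ) := by
  rw [sub_le_iff_le_add, div_le_iff₀ (by exact_mod_cast hb)]
  have := Int.lt_ediv_add_one_mul_self a hb
  exact_mod_cast this.le

theorem IsLowerApprox.sum_cast_le {Z : Matrix ι κ ℤ} {M : Matrix ι κ ℝ} {Δ : ℝ}
    (h : IsLowerApprox N Z M Δ) (hN : 0 < N) (hM : ∀ i, ∑ j, M i j ≤ 1) (i : ι) :
    ∑ j, (Z i j : ℝ) ≤ N := by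
  calc ∑ j, (Z i j : ℝ) ≤ ∑ j, N * M i j := Finset.sum_le_sum fun j _ => h.le i j
    _ = N * ∑ j, M i j := by rw [Finset.mul_sum]
    _ ≤ N * 1 := mul_le_mul_of_nonneg_left (hM i) (by exact_mod_cast hN.le)
    _ = N := mul_one _

theorem IsLowerApprox.rowBounded {Z : Matrix ι κ ℤ} {M : Matrix ι κ ℝ} {Δ : ℝ}
    (h : IsLowerApprox N Z M Δ) (hN : 0 < N) (hM : ∀ i, ∑ j, M i j ≤ 1) : RowBounded N Z :=
  ⟨h.nonneg, fun i => by exact_mod_cast h.sum_cast_le hN hM i⟩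

theorem IsLowerApprox.mono {Z : Matrix ι κ ℤ} {M : Matrix ι κ ℝ} {Δ Δ' : ℝ}
    (h : IsLowerApprox N Z M Δ) (hΔ : Δ ≤ Δ') : IsLowerApprox N Z M Δ' :=
  ⟨h.nonneg, h.le, fun i => (h.sum_le i).trans hΔ⟩

/-- The error before rounding splits as `(N L - Y) M + (Y / N) (N M - Z)`. Both `M` and `Y / N` have
row sums at most one, so the two errors add without amplification; the floors cost at most one per
column. -/
theorem IsLowerApprox.roundMul (hN : 0 < N) {Y : Matrix ι κ ℤ} {Z : Matrix κ τ ℤ}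
    {L : Matrix ι κ ℝ} {M : Matrix κ τ ℝ} {Δ Δ' : ℝ} (hY : IsLowerApprox N Y L Δ)
    (hZ : IsLowerApprox N Z M Δ') (hL : ∀ i, ∑ j, L i j ≤ 1)
    (hM : ∀ i, ∑ j, M i j ≤ 1) (hΔ' : 0 ≤ Δ') :
    IsLowerApprox N (roundMul N Y Z) (L * M) (Δ + Δ' + Fintype.card τ) where
  nonneg i j := Int.ediv_nonneg
    (Finset.sum_nonneg fun k _ => mul_nonneg (hY.nonneg i k) (hZ.nonneg k j)) hN.le
  le i j := by
    have hN' : (0 : ℝ) < N := by exact_mod_cast hN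
    refine (Int.cast_ediv_le _ _ hN).trans ?_
    rw [div_le_iff₀ hN', Matrix.mul_apply, Matrix.mul_apply]
    push_cast
    rw [Finset.mul_sum, Finset.sum_mul]
    refine Finset.sum_le_sum fun k _ => ?_
    calc (Y i k : ℝ) * Z k j ≤ (N * L i k) * (N * M k j) :=
          mul_le_mul (hY.le i k) (hZ.le k j) (by exact_mod_cast hZ.nonneg k j)
            (le_trans (by exact_mod_cast hY.nonneg i k) (hY.le i k))
      _ = N * (L i k * M k j) * N := by ring
  sum_le i := by
    have hN' : (0 : ℝ) < N := by exact_mod_cast hN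
    have h1 : ∀ j, N * (L * M) i j - (_root_.roundMul N Y Z i j : ℝ) ≤
        (∑ k, ((N * L i k - Y i k) * M k j + Y i k / N * (N * M k j - Z k j))) + 1 := by
      intro j
      have h2 := Int.div_sub_one_le_cast_ediv ((Y * Z) i j) N hN
      change (((Y * Z) i j : ℤ) : ℝ) / N - 1 ≤ (_root_.roundMul N Y Z i j : ℝ) at h2
      have h3 : (∑ k, ((N * L i k - Y i k) * M k j + Y i k / N * (N * M k j - Z k j))) =
          N * (L * M) i j - (((Y * Z) i j : ℤ) : ℝ) / N := by
        rw [Matrix.mul_apply, Matrix.mul_apply, Finset.mul_sum]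
        push_cast
        rw [Finset.sum_div, ← Finset.sum_sub_distrib]
        refine Finset.sum_congr rfl fun k _ => ?_
        field_simp
        ring
      linarith
    refine (Finset.sum_le_sum fun j _ => h1 j).trans ?_
    rw [Finset.sum_add_distrib, Finset.sum_const, Finset.card_univ, nsmul_eq_mul, mul_one,
      Finset.sum_comm]
    simp only [Finset.sum_add_distrib, ← Finset.mul_sum]
    have h4 : ∑ k, (N * L i k - Y i k) * ∑ j, M k j ≤ Δ := by
      refine le_trans (Finset.sum_le_sum fun k _ => ?_) (hY.sum_le i)
      exact mul_le_of_le_one_right (sub_nonneg.2 (hY.le i k)) (hM k)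
    have h5 : ∑ k, (Y i k / N : ℝ) * ∑ j, (N * M k j - Z k j) ≤ Δ' := by
      calc ∑ k, (Y i k / N : ℝ) * ∑ j, (N * M k j - Z k j) ≤ ∑ k, (Y i k / N : ℝ) * Δ' :=
            Finset.sum_le_sum fun k _ => mul_le_mul_of_nonneg_left (hZ.sum_le k)
              (div_nonneg (by exact_mod_cast hY.nonneg i k) hN'.le)
        _ = (∑ k, (Y i k : ℝ)) / N * Δ' := by rw [← Finset.sum_mul, Finset.sum_div]
        _ ≤ 1 * Δ' := mul_le_mul_of_nonneg_right
            ((div_le_one hN').2 (hY.sum_cast_le hN hL i)) hΔ'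
        _ = Δ' := one_mul _
    linarith

theorem Matrix.sum_pow_apply_le_one [DecidableEq κ] {M : Matrix κ κ ℝ} (hM : ∀ i j, 0 ≤ M i j)
    (hM1 : ∀ i, ∑ j, M i j ≤ 1) (m : ℕ) (i : κ) : ∑ j, (M ^ m) i j ≤ 1 := by
  induction m with
  | zero => simp [Matrix.one_apply]
  | succ m ih =>
    simp only [pow_succ, Matrix.mul_apply]
    rw [Finset.sum_comm]
    simp only [← Finset.mul_sum]
    exact le_trans (Finset.sum_le_sum fun k _ =>
      mul_le_of_le_one_right (Matrix.pow_apply_nonneg hM m i k) (hM1 k)) ih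

/-- Repeated squaring with rounding: the error in the row sums only doubles in each step. -/
theorem IsLowerApprox.iterate_roundMul [DecidableEq κ] (hN : 0 < N) {Z : Matrix κ κ ℤ}
    {M : Matrix κ κ ℝ} {Δ : ℝ} (hZ : IsLowerApprox N Z M Δ) (hM0 : ∀ i j, 0 ≤ M i j)
    (hM : ∀ i, ∑ j, M i j ≤ 1) (hΔ : 0 ≤ Δ) (t : ℕ) :
    IsLowerApprox N ((fun Z => _root_.roundMul N Z Z)^[t] Z) (M ^ 2 ^ t)
      (2 ^ t * (Δ + Fintype.card κ)) := by
  have hpow : ∀ m : ℕ, (∀ i j, 0 ≤ (M ^ m) i j) ∧ ∀ i, ∑ j, (M ^ m) i j ≤ 1 :=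
    fun m => ⟨Matrix.pow_apply_nonneg hM0 m, Matrix.sum_pow_apply_le_one hM0 hM m⟩
  -- The error obeys `e ↦ 2 e + card κ`, so `e + card κ` exactly doubles; subtracting `card κ` makes
  -- the induction close.
  have key : IsLowerApprox N ((fun Z => _root_.roundMul N Z Z)^[t] Z) (M ^ 2 ^ t)
      (2 ^ t * (Δ + Fintype.card κ) - Fintype.card κ) := by
    induction t with
    | zero => simpa using hZ
    | succ t ih =>
      rw [Function.iterate_succ_apply', pow_succ 2 t, pow_mul, sq]
      refine (ih.roundMul hN ih (hpow _).2 (hpow _).2 ?_).mono (le_of_eq ?_)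
      · have h1 : (1 : ℝ) ≤ 2 ^ t := one_le_pow₀ (by norm_num)
        have h2 : (0 : ℝ) ≤ Fintype.card κ := Nat.cast_nonneg _
        nlinarith
      · rw [pow_succ]
        ring
  exact key.mono (sub_le_self _ (Nat.cast_nonneg _))

end Rounding

/-! ### Hitting times of the random walk. -/

section RandomWalk

variable {V : Type*} [Fintype V] [DecidableEq V]

theorem Finset.sum_mem_add_sum_notMem (S : Finset V) (f : V → ℝ) :
    ∑ x : {x // x ∈ S}, f x + ∑ x : {x // x ∉ S}, f x = ∑ x, f x := by
  convert Fintype.sum_subtype_add_sum_subtype (· ∈ S) f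

/-- If `M h = h - e` with `M`, `h` nonnegative and `M e ≤ e`, then `M ^ m e ≤ h / m`. -/
theorem mul_pow_mulVec_le {M : Matrix V V ℝ} (hM : ∀ x y, 0 ≤ M x y) {e h : V → ℝ}
    (he : ∀ x, M.mulVec e x ≤ e x) (hh : M.mulVec h = h - e) (h0 : ∀ x, 0 ≤ h x) (m : ℕ)
    (x : V) : m * (M ^ m).mulVec e x ≤ h x := by
  have hpow := Matrix.pow_apply_nonneg hM
  -- By telescoping, the sum of `M ^ j e` over `j < m` is `h - M ^ m h`. The summands decrease in
  -- `j`, so the sum is at least `m` times `M ^ m e`.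
  have key : m * (M ^ m).mulVec e x + (M ^ m).mulVec h x ≤ h x := by
    induction m with
    | zero => simp
    | succ m ih =>
      have h1 : (M ^ (m + 1)).mulVec h x = (M ^ m).mulVec h x - (M ^ m).mulVec e x := by
        rw [pow_succ, ← Matrix.mulVec_mulVec, hh, Matrix.mulVec_sub]
        rfl
      have h2 : (M ^ (m + 1)).mulVec e x ≤ (M ^ m).mulVec e x := by
        rw [pow_succ, ← Matrix.mulVec_mulVec]
        exact Finset.sum_le_sum fun y _ => mul_le_mul_of_nonneg_left (he y) (hpow m x y)
      push_cast
      have h3 : ((m : ℝ) + 1) * (M ^ (m + 1)).mulVec e x ≤ (m + 1) * (M ^ m).mulVec e x :=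
        mul_le_mul_of_nonneg_left h2 (by positivity)
      linarith
  have h4 : 0 ≤ (M ^ m).mulVec h x :=
    Finset.sum_nonneg fun y _ => mul_nonneg (hpow m x y) (h0 y)
  linarith

/-- Here `h` plays the role of an expected killing time: Markov's inequality bounds the probability
of surviving `m` steps by `h / m`. -/
theorem tendsto_pow_mulVec_zero {M : Matrix V V ℝ} (hM : ∀ x y, 0 ≤ M x y) {h : V → ℝ}
    (he : ∀ x, ∑ y, M x y ≤ 1) (hh : M.mulVec h = h - 1) (h0 : ∀ x, 0 ≤ h x) (f : V → ℝ)
    (x : V) : Filter.Tendsto (fun m : ℕ => (M ^ m).mulVec f x) Filter.atTop (nhds 0) := by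
  have hpow := Matrix.pow_apply_nonneg hM
  have h1 := mul_pow_mulVec_le hM (e := 1) (h := h)
    (fun x => by simpa [Matrix.mulVec, dotProduct] using he x) hh h0
  refine squeeze_zero_norm' (a := fun m : ℕ => ((∑ y, |f y|) * h x) / m) ?_
    (tendsto_const_div_atTop_nhds_zero_nat _)
  filter_upwards [Filter.eventually_gt_atTop 0] with m hm
  have hm' : (0 : ℝ) < m := by exact_mod_cast hm
  rw [le_div_iff₀ hm', Real.norm_eq_abs]
  have h2 : |(M ^ m).mulVec f x| ≤ (∑ y, |f y|) * (M ^ m).mulVec 1 x := by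
    calc |(M ^ m).mulVec f x| ≤ ∑ y, |(M ^ m) x y * f y| := Finset.abs_sum_le_sum_abs _ _
      _ ≤ ∑ y, (∑ z, |f z|) * ((M ^ m) x y * 1) := by
        refine Finset.sum_le_sum fun y _ => ?_
        rw [abs_mul, abs_of_nonneg (hpow m x y), mul_one, mul_comm]
        exact mul_le_mul_of_nonneg_right
          (Finset.single_le_sum (fun z _ => abs_nonneg (f z)) (Finset.mem_univ y)) (hpow m x y)
      _ = _ := by rw [← Finset.mul_sum]; rfl
  calc |(M ^ m).mulVec f x| * m ≤ ((∑ y, |f y|) * (M ^ m).mulVec 1 x) * m :=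
        mul_le_mul_of_nonneg_right h2 hm'.le
    _ = (∑ y, |f y|) * (m * (M ^ m).mulVec 1 x) := by ring
    _ ≤ _ := mul_le_mul_of_nonneg_left (h1 m x) (Finset.sum_nonneg fun y _ => abs_nonneg _)

/-- This is the uniqueness principle by which two solutions of the same first-step equation are
identified: a fixed vector equals its images under all powers, which tend to zero. -/
theorem eq_zero_of_mulVec_eq_self {M : Matrix V V ℝ} (hM : ∀ x y, 0 ≤ M x y) {h : V → ℝ}
    (he : ∀ x, ∑ y, M x y ≤ 1) (hh : M.mulVec h = h - 1) (h0 : ∀ x, 0 ≤ h x) {f : V → ℝ}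
    (hf : M.mulVec f = f) : f = 0 := by
  funext x
  have h1 := tendsto_pow_mulVec_zero hM he hh h0 f x
  have h2 : ∀ m : ℕ, (M ^ m).mulVec f = f := by
    intro m
    induction m with
    | zero => simp
    | succ m ih => rw [pow_succ, ← Matrix.mulVec_mulVec, hf, ih]
  simp only [h2] at h1
  exact tendsto_nhds_unique tendsto_const_nhds h1

variable (G : SimpleGraph V) [DecidableRel G.Adj] (S : Finset V)

omit [DecidableEq V] in
theorem walkMatrix_nonneg (x y : V) : 0 ≤ walkMatrix G x y := by
  simp only [walkMatrix, Matrix.of_apply]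
  split_ifs <;> positivity

omit [DecidableEq V] in
theorem walkMatrix_sum_eq (x : V) (f : V → ℝ) :
    ∑ y, walkMatrix G x y * f y = 1 / (G.degree x : ℝ) * ∑ y ∈ G.neighborFinset x, f y := by
  rw [← Finset.sum_subset (Finset.subset_univ (G.neighborFinset x)), Finset.mul_sum]
  · refine Finset.sum_congr rfl fun y hy => ?_
    rw [SimpleGraph.mem_neighborFinset] at hy
    simp [walkMatrix, hy]
  · intro y _ hy
    rw [SimpleGraph.mem_neighborFinset] at hy
    simp [walkMatrix, hy]

omit [DecidableEq V] in
theorem walkMatrix_sum_le_one (x : V) : ∑ y, walkMatrix G x y ≤ 1 := by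
  have h := walkMatrix_sum_eq G x (fun _ => 1)
  simp only [mul_one, Finset.sum_const, SimpleGraph.card_neighborFinset_eq_degree,
    nsmul_eq_mul] at h
  rw [h, one_div, inv_mul_eq_div]
  exact div_self_le_one _

theorem lapMatrix_mulVec_eq_walkMatrix (f : V → ℝ) (x : V) :
    (G.lapMatrix ℝ).mulVec f x = G.degree x * (f x - (walkMatrix G).mulVec f x) := by
  rw [SimpleGraph.lapMatrix_mulVec_apply, Matrix.mulVec, dotProduct, walkMatrix_sum_eq]
  by_cases h : G.degree x = 0
  · have : G.neighborFinset x = ∅ := by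
      rw [← Finset.card_eq_zero, SimpleGraph.card_neighborFinset_eq_degree, h]
    simp [h, this]
  · have : (G.degree x : ℝ) ≠ 0 := by exact_mod_cast h
    field_simp

variable {G S}

omit [DecidableEq V] in
theorem SimpleGraph.Connected.degree_pos_of_ne (hG : G.Connected) {x y : V} (h : x ≠ y) :
    (0 : ℝ) < G.degree x := by
  exact_mod_cast (hG.preconnected x y).degree_pos_left h

/-- The expected hitting time of `S` is polynomially bounded. -/
theorem exists_hittingTime (hG : G.Connected) (hS : S.Nonempty) :
    ∃ h : V → ℝ, (∀ x ∈ S, h x = 0) ∧ (∀ x, 0 ≤ h x) ∧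
      (∀ x, x ∉ S → h x = 1 + (walkMatrix G).mulVec h x) ∧
      ∀ x, h x ≤ (Fintype.card V : ℝ) ^ 4 := by
  obtain ⟨s, hs⟩ := hS
  set L := (G.lapMatrix ℝ).toBlock (· ∉ S) (· ∉ S) with hL
  have hdet := isUnit_det_lapMatrix_toBlock G S hG ⟨s, hs⟩
  have hinv := inv_nonneg_of_posSemidef_of_offDiag_nonpos L
    ((SimpleGraph.posSemidef_lapMatrix ℝ G).submatrix _)
    (fun i j hij => lapMatrix_offDiag_nonpos G i j (fun e => hij (Subtype.ext e)))
  -- Solving `L y = deg` outside `S` is the equation `h = 1 + W h` multiplied by the degrees;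
  -- nonnegativity comes from the nonnegative inverse.
  let y : {x // x ∉ S} → ℝ := L⁻¹.mulVec fun x => (G.degree x.1 : ℝ)
  have hLy : L.mulVec y = fun x => (G.degree x.1 : ℝ) := by
    rw [Matrix.mulVec_mulVec, Matrix.mul_nonsing_inv _ hdet, Matrix.one_mulVec]
  let h : V → ℝ := fun x => if hx : x ∉ S then y ⟨x, hx⟩ else 0
  have hin : ∀ x ∈ S, h x = 0 := fun x hx => by simp [h, hx]
  have hout : ∀ x : {x // x ∉ S}, h x = y x := fun x => by simp [h, x.2]
  have h0 : ∀ x, 0 ≤ h x := by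
    intro x
    by_cases hx : x ∈ S
    · rw [hin x hx]
    · rw [hout ⟨x, hx⟩]
      exact Finset.sum_nonneg fun z _ => mul_nonneg (hinv _ z) (Nat.cast_nonneg _)
  have hLh : ∀ x, x ∉ S → (G.lapMatrix ℝ).mulVec h x = G.degree x := by
    intro x hx
    rw [Matrix.mulVec, dotProduct, ← Finset.sum_mem_add_sum_notMem S,
      Finset.sum_eq_zero fun z _ => by rw [hin z z.2, mul_zero], zero_add]
    simp only [hout]
    exact congrFun hLy ⟨x, hx⟩
  refine ⟨h, hin, h0, fun x hx => ?_, fun x => ?_⟩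
  · have h1 := hLh x hx
    rw [lapMatrix_mulVec_eq_walkMatrix] at h1
    have h2 := hG.degree_pos_of_ne (x := x) (y := s) (fun e => hx (e ▸ hs))
    have h3 := mul_left_cancel₀ h2.ne' (h1.trans (mul_one _).symm)
    linarith
  · obtain ⟨m, -, hm⟩ := Finset.exists_max_image Finset.univ h ⟨s, Finset.mem_univ s⟩
    refine (hm x (Finset.mem_univ x)).trans ?_
    have hm := fun x => hm x (Finset.mem_univ x)
    set n : ℝ := (Fintype.card V : ℝ) with hn
    have hn0 : 0 ≤ n := Nat.cast_nonneg _
    -- Let `m` maximize `h`. The energy `E = hᵀ L h` is at most `n ^ 2 * h m`, because `L h` is the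
    -- degree wherever `h` can be nonzero. Each edge changes `h` by at most `√E`, so a path from `m`
    -- to `S` gives `h m ≤ n √E`. Together, `h m ^ 2 ≤ n ^ 4 * h m`.
    set E := (∑ i, ∑ j, if G.Adj i j then (h i - h j) ^ 2 else 0) / 2 with hE
    have hE1 : E ≤ n ^ 2 * h m := by
      rw [hE, ← SimpleGraph.lapMatrix_toLinearMap₂', Matrix.toLinearMap₂'_apply']
      calc ∑ x, h x * (G.lapMatrix ℝ).mulVec h x ≤ ∑ _x : V, h m * n := by
            refine Finset.sum_le_sum fun x _ => ?_
            by_cases hx : x ∈ S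
            · rw [hin x hx, zero_mul]
              exact mul_nonneg (h0 m) hn0
            · rw [hLh x hx]
              refine mul_le_mul (hm x) ?_ (Nat.cast_nonneg _) (h0 m)
              rw [hn]
              exact_mod_cast (G.degree_lt_card_verts x).le
        _ = n ^ 2 * h m := by
            rw [Finset.sum_const, Finset.card_univ, nsmul_eq_mul, ← hn]
            ring
    have hE2 : ∀ i j, G.Adj i j → (h i - h j) ^ 2 ≤ E := by
      intro i j hij
      have hterm : ∀ i j, (0 : ℝ) ≤ if G.Adj i j then (h i - h j) ^ 2 else 0 := by
        intro i j
        split_ifs <;> positivity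
      have h1 : ∀ i j, G.Adj i j →
          (h i - h j) ^ 2 ≤ ∑ j, if G.Adj i j then (h i - h j) ^ 2 else 0 := by
        intro i j hij
        have := Finset.single_le_sum (fun k _ => hterm i k) (Finset.mem_univ j)
        rwa [if_pos hij] at this
      -- Each edge occurs in both orders, which makes up for the factor `1 / 2` in `E`.
      have h2 : (h i - h j) ^ 2 + (h j - h i) ^ 2 ≤
          ∑ i, ∑ j, if G.Adj i j then (h i - h j) ^ 2 else 0 := by
        refine (add_le_add (h1 i j hij) (h1 j i hij.symm)).trans ?_
        exact Finset.add_le_sum (fun i _ => Finset.sum_nonneg fun j _ => hterm i j)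
          (Finset.mem_univ i) (Finset.mem_univ j) hij.ne
      rw [hE]
      nlinarith
    have hE0 : 0 ≤ E := le_trans (by positivity) (div_nonneg (Finset.sum_nonneg fun i _ =>
      Finset.sum_nonneg fun j _ => by split_ifs <;> positivity) two_pos.le : (0 : ℝ) ≤ E)
    have hwalk : ∀ {a b : V} (p : G.Walk a b), h a ≤ h b + p.length * √E := by
      intro a b p
      induction p with
      | nil => simp
      | cons hadj p ih =>
        have h1 := Real.le_sqrt_of_sq_le (hE2 _ _ hadj)
        rw [SimpleGraph.Walk.length_cons]
        push_cast
        linarith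
    obtain ⟨p, hp⟩ := hG.preconnected.exists_isPath m s
    have h1 := hwalk p
    rw [hin s hs, zero_add] at h1
    have h2 : (p.length : ℝ) ≤ n := by
      rw [hn]
      exact_mod_cast hp.length_lt.le
    have h3 : h m ≤ n * √E := h1.trans (mul_le_mul_of_nonneg_right h2 (Real.sqrt_nonneg _))
    have h4 : h m ^ 2 ≤ n ^ 2 * E := by
      calc h m ^ 2 ≤ (n * √E) ^ 2 := pow_le_pow_left₀ (h0 m) h3 2
        _ = n ^ 2 * E := by rw [mul_pow, Real.sq_sqrt hE0]
    have h5 : h m ^ 2 ≤ n ^ 4 * h m := by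
      calc h m ^ 2 ≤ n ^ 2 * (n ^ 2 * h m) := h4.trans (mul_le_mul_of_nonneg_left hE1 (by positivity))
        _ = n ^ 4 * h m := by ring
    rcases (h0 m).eq_or_lt with h6 | h6
    · rw [← h6]
      positivity
    · exact le_of_mul_le_mul_right (by rwa [← sq]) h6

/-! ### Hitting distributions, first returns and the Schur complement. -/

variable (G S)

/-- `harmonicMatrix G S x v` is the probability that the random walk on `G` started at `x` first
hits `S` (at time zero or later) in `v`. -/
noncomputable def harmonicMatrix : Matrix V S ℝ :=
  Matrix.of fun x v => if h : x ∉ S then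
    -(((G.lapMatrix ℝ).toBlock (· ∉ S) (· ∉ S))⁻¹ *
      (G.lapMatrix ℝ).toBlock (· ∉ S) (· ∈ S)) ⟨x, h⟩ v
    else if x = v then 1 else 0

/-- The transition matrix of the walk on `G` that stops upon reaching `S`. -/
noncomputable def absorbedMatrix : Matrix V V ℝ :=
  Matrix.of fun x y => if x ∈ S then (if x = y then 1 else 0) else walkMatrix G x y

/-- The substochastic matrix of the steps of the walk on `G` that end outside `S`. -/
noncomputable def avoidingMatrix : Matrix V V ℝ :=
  Matrix.of fun x y => if y ∈ S then 0 else walkMatrix G x y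

/-- `returnMatrix G S x v` is the probability that the random walk on `G` started at `x` hits `S`
for the first time at a positive time in `v`. -/
noncomputable def returnMatrix : Matrix V S ℝ := walkMatrix G * harmonicMatrix G S

variable {G S}

theorem harmonicMatrix_of_mem {x : V} (hx : x ∈ S) (v : S) :
    harmonicMatrix G S x v = if x = v then 1 else 0 := by
  simp [harmonicMatrix, hx]

theorem harmonicMatrix_of_notMem (x : {x // x ∉ S}) (v : S) :
    harmonicMatrix G S x v = -(((G.lapMatrix ℝ).toBlock (· ∉ S) (· ∉ S))⁻¹ *
      (G.lapMatrix ℝ).toBlock (· ∉ S) (· ∈ S)) x v := by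
  simp [harmonicMatrix, x.2]

theorem harmonicMatrix_nonneg (x : V) (v : S) : 0 ≤ harmonicMatrix G S x v := by
  by_cases hx : x ∈ S
  · rw [harmonicMatrix_of_mem hx]
    split_ifs <;> norm_num
  · have hinv := inv_nonneg_of_posSemidef_of_offDiag_nonpos
      ((G.lapMatrix ℝ).toBlock (· ∉ S) (· ∉ S))
      ((SimpleGraph.posSemidef_lapMatrix ℝ G).submatrix _)
      (fun i j hij => lapMatrix_offDiag_nonpos G i j (fun e => hij (Subtype.ext e)))
    rw [harmonicMatrix_of_notMem ⟨x, hx⟩, neg_nonneg, Matrix.mul_apply]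
    exact Finset.sum_nonpos fun b _ => mul_nonpos_of_nonneg_of_nonpos (hinv _ b)
      (lapMatrix_offDiag_nonpos G _ _ (fun e => b.2 (e ▸ v.2)))

/-- In the rows of `S` the right side is the Schur complement; in the other rows the inverse cancels
and it is zero. Both readings are used below. -/
theorem lapMatrix_mul_harmonicMatrix (x : V) (v : S) :
    (G.lapMatrix ℝ * harmonicMatrix G S) x v = G.lapMatrix ℝ x v -
      ∑ t : {t // t ∉ S}, G.lapMatrix ℝ x t * (((G.lapMatrix ℝ).toBlock (· ∉ S) (· ∉ S))⁻¹ *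
        (G.lapMatrix ℝ).toBlock (· ∉ S) (· ∈ S)) t v := by
  rw [Matrix.mul_apply, ← Finset.sum_mem_add_sum_notMem S, sub_eq_add_neg,
    ← Finset.sum_neg_distrib]
  congr 1
  · rw [Finset.sum_eq_single v]
    · rw [harmonicMatrix_of_mem v.2, if_pos rfl, mul_one]
    · intro b _ hb
      rw [harmonicMatrix_of_mem b.2, if_neg (fun e => hb (Subtype.ext e)), mul_zero]
    · simp
  · refine Finset.sum_congr rfl fun t _ => ?_
    rw [harmonicMatrix_of_notMem, mul_neg]

theorem schurComplement_eq (u v : S) :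
    schurComplement (G.lapMatrix ℝ) S u v =
      G.degree u.1 * ((if u = v then 1 else 0) - returnMatrix G S u v) := by
  have h1 := lapMatrix_mulVec_eq_walkMatrix G (fun x => harmonicMatrix G S x v) u
  change (G.lapMatrix ℝ * harmonicMatrix G S) u v = G.degree u.1 *
    (harmonicMatrix G S u v - returnMatrix G S u v) at h1
  rw [harmonicMatrix_of_mem u.2, lapMatrix_mul_harmonicMatrix] at h1
  simp only [Subtype.ext_iff]
  rw [← h1, schurComplement, Matrix.mul_assoc]
  rfl

/-- Outside `S` the product `L H` vanishes, so `L = D (1 - W)` with positive degrees forces `H = W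
H` there. -/
theorem harmonicMatrix_eq_returnMatrix (hG : G.Connected) (hS : S.Nonempty) {x : V}
    (hx : x ∉ S) (v : S) : harmonicMatrix G S x v = returnMatrix G S x v := by
  have hdet := isUnit_det_lapMatrix_toBlock G S hG hS
  have h1 := lapMatrix_mulVec_eq_walkMatrix G (fun x => harmonicMatrix G S x v) x
  change (G.lapMatrix ℝ * harmonicMatrix G S) x v = G.degree x *
    (harmonicMatrix G S x v - returnMatrix G S x v) at h1
  have h2 : ((G.lapMatrix ℝ).toBlock (· ∉ S) (· ∉ S) *
      (((G.lapMatrix ℝ).toBlock (· ∉ S) (· ∉ S))⁻¹ *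
        (G.lapMatrix ℝ).toBlock (· ∉ S) (· ∈ S))) ⟨x, hx⟩ v = G.lapMatrix ℝ x v := by
    rw [← Matrix.mul_assoc, Matrix.mul_nonsing_inv _ hdet, Matrix.one_mul]
    rfl
  rw [Matrix.mul_apply] at h2
  simp only [Matrix.toBlock_apply] at h2
  rw [lapMatrix_mul_harmonicMatrix, h2, sub_self] at h1
  have h3 := hG.degree_pos_of_ne (x := x) (y := v) (fun e => hx (e ▸ v.2))
  have h4 := (mul_eq_zero.1 h1.symm).resolve_left h3.ne'
  linarith

theorem harmonicMatrix_sum_eq_one (hG : G.Connected) (hS : S.Nonempty) (x : V) :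
    ∑ v, harmonicMatrix G S x v = 1 := by
  by_cases hx : x ∈ S
  · simp only [harmonicMatrix_of_mem hx]
    rw [Finset.sum_eq_single ⟨x, hx⟩]
    · simp
    · intro b _ hb
      rw [if_neg (fun e => hb (Subtype.ext e.symm))]
    · simp
  · have hdet := isUnit_det_lapMatrix_toBlock G S hG hS
    have h1 : (((G.lapMatrix ℝ).toBlock (· ∉ S) (· ∈ S)).mulVec fun _ => 1) =
        -((G.lapMatrix ℝ).toBlock (· ∉ S) (· ∉ S)).mulVec fun _ => 1 := by
      funext t
      have h2 := congrFun (G.lapMatrix_mulVec_const_eq_zero (R := ℝ)) t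
      rw [Matrix.mulVec, dotProduct, ← Finset.sum_mem_add_sum_notMem S] at h2
      simp only [Matrix.mulVec, dotProduct, Matrix.toBlock_apply, Pi.neg_apply]
      exact eq_neg_of_add_eq_zero_left h2
    have h3 : (((G.lapMatrix ℝ).toBlock (· ∉ S) (· ∉ S))⁻¹ *
        (G.lapMatrix ℝ).toBlock (· ∉ S) (· ∈ S)).mulVec (fun _ => 1) = fun _ => -1 := by
      rw [← Matrix.mulVec_mulVec, h1, Matrix.mulVec_neg, Matrix.mulVec_mulVec,
        Matrix.nonsing_inv_mul _ hdet, Matrix.one_mulVec]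
      rfl
    have h4 := congrFun h3 ⟨x, hx⟩
    simp only [Matrix.mulVec, dotProduct, mul_one] at h4
    have h5 : ∀ v, harmonicMatrix G S x v = _ := harmonicMatrix_of_notMem ⟨x, hx⟩
    simp only [h5, Finset.sum_neg_distrib, h4, neg_neg]

theorem returnMatrix_nonneg (x : V) (v : S) : 0 ≤ returnMatrix G S x v :=
  Finset.sum_nonneg fun y _ => mul_nonneg (walkMatrix_nonneg G x y) (harmonicMatrix_nonneg y v)

theorem returnMatrix_sum_le_one (hG : G.Connected) (hS : S.Nonempty) (x : V) :
    ∑ v, returnMatrix G S x v ≤ 1 := by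
  simp only [returnMatrix, Matrix.mul_apply]
  rw [Finset.sum_comm]
  simp only [← Finset.mul_sum, harmonicMatrix_sum_eq_one hG hS, mul_one]
  exact walkMatrix_sum_le_one G x

/-- The total weight at `u` is the diagonal entry of the Laplacian, namely `deg u * (1 - F u u)`
with `F` the return matrix. The degree also divides the off-diagonal weights and cancels. -/
theorem schurGraph_transition_apply (hG : G.Connected) (u v : S) :
    (schurGraph G S).transition u v =
      if u = v then 0 else returnMatrix G S u v / (1 - returnMatrix G S u u) := by
  have hS : S.Nonempty := ⟨u, u.2⟩
  by_cases huv : u = v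
  · subst huv
    simp [SimpleWeightedGraph.transition, (schurGraph G S).loopless]
  · have h1 := congrFun (congrFun (schurGraph_laplacian G S hG hS) u) u
    simp only [SimpleWeightedGraph.laplacian, Matrix.of_apply, if_true] at h1
    have h2 : (schurGraph G S).weight u v = G.degree u.1 * returnMatrix G S u v := by
      simp [schurGraph, schurComplement_eq, huv]
    have h3 := hG.degree_pos_of_ne (x := u.1) (y := v.1) (fun e => huv (Subtype.ext e))
    rw [SimpleWeightedGraph.transition, Matrix.of_apply, h1, h2, schurComplement_eq,
      if_pos rfl, if_neg huv, mul_div_mul_left _ _ h3.ne']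

theorem avoidingMatrix_nonneg (x y : V) : 0 ≤ avoidingMatrix G S x y := by
  simp only [avoidingMatrix, Matrix.of_apply]
  split_ifs
  exacts [le_rfl, walkMatrix_nonneg G x y]

theorem avoidingMatrix_sum_le_one (x : V) : ∑ y, avoidingMatrix G S x y ≤ 1 := by
  refine le_trans (Finset.sum_le_sum fun y _ => ?_) (walkMatrix_sum_le_one G x)
  simp only [avoidingMatrix, Matrix.of_apply]
  split_ifs
  exacts [walkMatrix_nonneg G x y, le_rfl]

/-- The expected first positive hitting time of `S` is polynomially bounded. -/
theorem exists_returnTime (hG : G.Connected) (hS : S.Nonempty) :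
    ∃ h : V → ℝ, (avoidingMatrix G S).mulVec h = h - 1 ∧ (∀ x, 1 ≤ h x) ∧
      ∀ x, h x ≤ (Fintype.card V : ℝ) ^ 4 + 1 := by
  obtain ⟨h, hin, h0, hout, hle⟩ := exists_hittingTime hG hS
  have h1 : ∀ x, (walkMatrix G).mulVec h x ≤ (Fintype.card V : ℝ) ^ 4 := by
    intro x
    calc ∑ y, walkMatrix G x y * h y ≤ ∑ y, walkMatrix G x y * (Fintype.card V : ℝ) ^ 4 :=
          Finset.sum_le_sum fun y _ => mul_le_mul_of_nonneg_left (hle y) (walkMatrix_nonneg G x y)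
      _ = (∑ y, walkMatrix G x y) * (Fintype.card V : ℝ) ^ 4 := by rw [Finset.sum_mul]
      _ ≤ _ := mul_le_of_le_one_left (by positivity) (walkMatrix_sum_le_one G x)
  have h2 : ∀ x, 0 ≤ (walkMatrix G).mulVec h x := fun x =>
    Finset.sum_nonneg fun y _ => mul_nonneg (walkMatrix_nonneg G x y) (h0 y)
  -- One step plus the hitting time from its endpoint. Outside `S` this function agrees with `h`,
  -- and `h` vanishes on `S`, so masking the columns of `S` loses nothing.
  refine ⟨fun x => 1 + (walkMatrix G).mulVec h x, ?_, fun x => ?_, fun x => ?_⟩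
  · funext x
    simp only [Pi.sub_apply, Pi.one_apply, add_sub_cancel_left]
    refine Finset.sum_congr rfl fun y _ => ?_
    by_cases hy : y ∈ S
    · simp [avoidingMatrix, hy, hin y hy]
    · change _ * (1 + (walkMatrix G).mulVec h y) = _
      rw [← hout y hy]
      simp [avoidingMatrix, hy]
  · linarith [h2 x]
  · linarith [h1 x]

/-- First-step analysis: the first step either ends outside `S`, where hitting and returning have
the same law, or ends in `S` and decides the return. -/
theorem returnMatrix_eq (hG : G.Connected) (hS : S.Nonempty) :
    returnMatrix G S = avoidingMatrix G S * returnMatrix G S +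
      (walkMatrix G).submatrix id Subtype.val := by
  ext x v
  rw [returnMatrix, Matrix.mul_apply, ← Finset.sum_mem_add_sum_notMem S, add_comm,
    Matrix.add_apply]
  congr 1
  · rw [Matrix.mul_apply, ← Finset.sum_mem_add_sum_notMem S,
      Finset.sum_eq_zero (s := (Finset.univ : Finset {x // x ∈ S})), zero_add]
    · refine Finset.sum_congr rfl fun y _ => ?_
      rw [harmonicMatrix_eq_returnMatrix hG hS y.2]
      simp [avoidingMatrix, y.2, returnMatrix]
    · intro y _
      simp [avoidingMatrix]
  · rw [Finset.sum_eq_single v]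
    · simp [harmonicMatrix_of_mem v.2]
    · intro b _ hb
      rw [harmonicMatrix_of_mem b.2, if_neg (fun e => hb (Subtype.ext e)), mul_zero]
    · simp

/-- Iterating `returnMatrix_eq` gives the partial sums with remainder `M ^ m F`, where `M` is the
avoiding matrix and `F` the return matrix. The remainder tends to zero because the return time has
finite expectation. -/
theorem hasSum_returnMatrix (hG : G.Connected) (hS : S.Nonempty) (x : V) (v : S) :
    HasSum (fun j : ℕ => (avoidingMatrix G S ^ j * walkMatrix G) x v) (returnMatrix G S x v) := by
  obtain ⟨h, hh, h1, -⟩ := exists_returnTime hG hS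
  have hpow := Matrix.pow_apply_nonneg (avoidingMatrix_nonneg (G := G) (S := S))
  have hterm : ∀ j : ℕ, 0 ≤ (avoidingMatrix G S ^ j * walkMatrix G) x v := fun j =>
    Finset.sum_nonneg fun y _ => mul_nonneg (hpow j x y) (walkMatrix_nonneg G y v)
  rw [hasSum_iff_tendsto_nat_of_nonneg hterm]
  have h2 : ∀ m : ℕ, ∑ j ∈ Finset.range m, (avoidingMatrix G S ^ j * walkMatrix G) x v =
      returnMatrix G S x v -
        (avoidingMatrix G S ^ m).mulVec (fun y => returnMatrix G S y v) x := by
    intro m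
    induction m with
    | zero => simp
    | succ m ih =>
      rw [Finset.sum_range_succ, ih]
      have h3 : (fun y => returnMatrix G S y v) = (avoidingMatrix G S).mulVec
          (fun y => returnMatrix G S y v) + fun y => walkMatrix G y v := by
        funext y
        exact congrFun (congrFun (returnMatrix_eq hG hS) y) v
      conv_lhs => rw [h3, Matrix.mulVec_add, Matrix.mulVec_mulVec, ← pow_succ]
      simp only [Pi.add_apply]
      change _ - (_ + (avoidingMatrix G S ^ m * walkMatrix G) x v) + _ = _
      ring
  simp only [h2]
  have h4 := tendsto_pow_mulVec_zero avoidingMatrix_nonneg avoidingMatrix_sum_le_one hh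
    (fun x => zero_le_one.trans (h1 x)) (fun y => returnMatrix G S y v) x
  simpa using h4.const_sub (returnMatrix G S x v)

/-- The escape probability from `u` to the rest of `S` is polynomially bounded from below. -/
theorem one_le_mul_one_sub_returnMatrix (hG : G.Connected) (hS : 2 ≤ S.card) (u : S) :
    1 ≤ ((Fintype.card V : ℝ) ^ 4 + 1) * (1 - returnMatrix G S u u) := by
  have hS0 : S.Nonempty := ⟨u, u.2⟩
  obtain ⟨h, hh, h1, -⟩ := exists_returnTime hG hS0
  have hS' : (S.erase u).Nonempty := by
    rw [← Finset.card_pos, Finset.card_erase_of_mem u.2]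
    omega
  obtain ⟨g, hg, hg1, hg2⟩ := exists_returnTime hG hS'
  -- Let `g` be the expected return time to `S` without `u`. Avoiding this smaller set additionally
  -- permits steps into `u`.
  have h3 : avoidingMatrix G (S.erase u) = avoidingMatrix G S +
      Matrix.of fun x y : V => if y = u.1 then walkMatrix G x u else 0 := by
    ext x y
    by_cases hy : y = u
    · subst hy
      simp [avoidingMatrix]
    · simp [avoidingMatrix, hy]
  have h4 : (Matrix.of fun x y : V => if y = u.1 then walkMatrix G x u else 0).mulVec g =
      g u • fun x => walkMatrix G x u := by
    funext x
    simp [Matrix.mulVec, dotProduct, mul_comm]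
  rw [h3, Matrix.add_mulVec, h4] at hg
  have h5 : (avoidingMatrix G S).mulVec (fun x => returnMatrix G S x u) =
      (fun x => returnMatrix G S x u) - fun x => walkMatrix G x u := by
    funext x
    rw [Pi.sub_apply, eq_sub_iff_add_eq]
    exact (congrFun (congrFun (returnMatrix_eq hG hS0) x) u).symm
  have h6 : g - g u • (fun x => returnMatrix G S x u) - h = 0 := by
    refine eq_zero_of_mulVec_eq_self avoidingMatrix_nonneg avoidingMatrix_sum_le_one hh
      (fun x => zero_le_one.trans (h1 x)) ?_
    rw [Matrix.mulVec_sub, Matrix.mulVec_sub, Matrix.mulVec_smul, h5, hh, eq_sub_of_add_eq hg,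
      smul_sub]
    abel
  have h7 := congrFun h6 u
  simp only [Pi.sub_apply, Pi.smul_apply, smul_eq_mul, Pi.zero_apply] at h7
  have h8 : 1 ≤ g u * (1 - returnMatrix G S u u) := by linarith [h1 u]
  have h9 : 0 ≤ 1 - returnMatrix G S u u := by
    by_contra h10
    have := mul_neg_of_pos_of_neg (zero_lt_one.trans_le (hg1 u)) (not_le.1 h10)
    linarith
  exact h8.trans (mul_le_mul_of_nonneg_right (hg2 u) h9)

end RandomWalk

/-! ### Path sums and the factorization through `Q R`. -/

section Shortcut

variable {V : Type*} [Fintype V] [DecidableEq V]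

omit [DecidableEq V] in
theorem Fin.sum_univ_fun_snoc {j : ℕ} (f : (Fin (j + 1) → V) → ℝ) :
    ∑ x, f x = ∑ y : Fin j → V, ∑ v : V, f (Fin.snoc y v) := by
  rw [← (Fin.snocEquiv fun _ : Fin (j + 1) => V).sum_comp, Fintype.sum_prod_type,
    Finset.sum_comm]
  rfl

/-- The entries of a matrix power are sums over paths. -/
theorem Matrix.pow_apply_eq_sum_paths (M : Matrix V V ℝ) (j : ℕ) (u w : V) :
    (M ^ j) u w = ∑ x : Fin (j + 1) → V, if x 0 = u ∧ x (Fin.last j) = w then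
      ∏ i : Fin j, M (x i.castSucc) (x i.succ) else 0 := by
  induction j generalizing w with
  | zero =>
    rw [← (Equiv.funUnique (Fin 1) V).symm.sum_comp]
    simp [Matrix.one_apply, ite_and, eq_comm]
  | succ j ih =>
    rw [Fin.sum_univ_fun_snoc, pow_succ, Matrix.mul_apply]
    simp only [ih, Finset.sum_mul]
    rw [Finset.sum_comm]
    refine Finset.sum_congr rfl fun y _ => ?_
    have h0 : ∀ v : V, (Fin.snoc y v : Fin (j + 2) → V) 0 = y 0 := fun v => by
      rw [← Fin.castSucc_zero, Fin.snoc_castSucc]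
    simp only [h0, Fin.snoc_last, Fin.prod_univ_castSucc, Fin.snoc_castSucc, Fin.succ_last,
      ← Fin.castSucc_succ]
    rw [Finset.sum_eq_single (y (Fin.last j)), Finset.sum_eq_single w]
    · by_cases hu : y 0 = u <;> simp [hu]
    · intro v _ hv
      rw [if_neg (fun e => hv e.2)]
    · simp
    · intro v _ hv
      rw [if_neg (fun e => hv e.2.symm), zero_mul]
    · simp

variable (G : SimpleGraph V) [DecidableRel G.Adj] (S : Finset V)

/-- Splitting off the last vertex of the path leaves a path of `j` steps avoiding `S`, counted by a
power of the avoiding matrix, followed by one step into `S`. -/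
theorem walkProb_eq (u w : V) (j : ℕ) :
    (walkProb G u (j + 1) fun x => (∀ i : Fin (j + 2), 0 < i.val → i.val < j + 1 → x i ∉ S) ∧
      x (Fin.last (j + 1)) ∈ S ∧ x (Fin.last j).castSucc = w) =
    (avoidingMatrix G S ^ j) u w * ∑ v ∈ S, walkMatrix G w v := by
  classical
  rw [walkProb, Fin.sum_univ_fun_snoc, Matrix.pow_apply_eq_sum_paths, Finset.sum_mul]
  refine Finset.sum_congr rfl fun y _ => ?_
  have h0 : ∀ v : V, (Fin.snoc y v : Fin (j + 2) → V) 0 = y 0 := fun v => by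
    rw [← Fin.castSucc_zero, Fin.snoc_castSucc]
  -- Only the times `1, …, j` are constrained: the start may lie in `S`.
  have h1 : ∀ v : V, (∀ i : Fin (j + 2), 0 < i.val → i.val < j + 1 →
      (Fin.snoc y v : Fin (j + 2) → V) i ∉ S) ↔ ∀ i : Fin j, y i.succ ∉ S := by
    intro v
    constructor
    · intro h i
      have := h i.succ.castSucc (by simp) (by simp)
      rwa [Fin.snoc_castSucc] at this
    · intro h i hi hj
      obtain ⟨k, rfl⟩ : ∃ k : Fin j, k.succ.castSucc = i :=
        ⟨⟨i.val - 1, by omega⟩, Fin.ext (by simp; omega)⟩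
      rw [Fin.snoc_castSucc]
      exact h k
  simp only [h0, h1, Fin.snoc_last, Fin.snoc_castSucc]
  have h2 : ∏ i : Fin j, avoidingMatrix G S (y i.castSucc) (y i.succ) =
      if ∀ i : Fin j, y i.succ ∉ S then ∏ i : Fin j, walkMatrix G (y i.castSucc) (y i.succ)
      else 0 := by
    split_ifs with h
    · refine Finset.prod_congr rfl fun i _ => ?_
      simp [avoidingMatrix, h i]
    · push Not at h
      obtain ⟨i, hi⟩ := h
      refine Finset.prod_eq_zero (Finset.mem_univ i) ?_
      simp [avoidingMatrix, hi]
  have h3 : ∀ v : V, ∏ i : Fin (j + 1), walkMatrix G (y i) ((Fin.snoc y v : Fin (j + 2) → V) i.succ) =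
      (∏ i : Fin j, walkMatrix G (y i.castSucc) (y i.succ)) *
        walkMatrix G (y (Fin.last j)) v := by
    intro v
    simp only [Fin.prod_univ_castSucc, Fin.snoc_castSucc, Fin.succ_last, Fin.snoc_last,
      Fin.succ_castSucc]
  simp only [h2]
  by_cases hu : y 0 = u
  swap
  · simp [hu]
  by_cases hw : y (Fin.last j) = w
  swap
  · simp [hw]
  by_cases hS : ∀ i : Fin j, y i.succ ∉ S
  swap
  · simp only [hS, false_and, and_false, if_false, ite_self, zero_mul,
      Finset.sum_const_zero]
  simp only [hu, hw, hS, true_and, and_true, if_true, not_false_eq_true, implies_true]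
  rw [Finset.mul_sum, ← Finset.sum_filter]
  refine Finset.sum_congr (by ext; simp) fun v _ => ?_
  rw [← hw]
  exact h3 v

/-- The walk steps into `S` with probability `deg_S / deg`, and `R` is the law of that step given
that it does so. Without neighbours in `S` the first factor is zero, so the value `1` on the
diagonal of `R` has no effect. -/
theorem walkMatrix_sum_mul_stepMatrix (w v : V) (hv : v ∈ S) :
    (∑ x ∈ S, walkMatrix G w x) * stepMatrix G S w v = walkMatrix G w v := by
  have h1 : ∑ x ∈ S, walkMatrix G w x = degreeIn G S w * (1 / (G.degree w : ℝ)) := by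
    rw [degreeIn, Finset.inter_comm, ← nsmul_eq_mul, ← Finset.sum_const,
      ← Finset.filter_mem_eq_inter, Finset.sum_filter]
    refine Finset.sum_congr rfl fun x _ => ?_
    simp [walkMatrix]
  rw [h1]
  by_cases hadj : G.Adj w v
  · have h2 : degreeIn G S w ≠ 0 := by
      rw [degreeIn, Finset.card_ne_zero]
      exact ⟨v, by simp [hadj, hv]⟩
    have h3 : (degreeIn G S w : ℝ) ≠ 0 := by exact_mod_cast h2
    simp only [stepMatrix, walkMatrix, Matrix.of_apply, h2, and_false, if_false, hadj, hv,
      true_and, if_true]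
    field_simp
  · by_cases h2 : degreeIn G S w = 0
    · simp [h2, walkMatrix, hadj]
    · simp [stepMatrix, walkMatrix, hadj, h2]

variable {G S}

/-- The first return to `S` is decomposed according to its time and the vertex just before it. Each
series over time is dominated by the convergent return series, which allows exchanging it with the
finite sum over vertices. -/
theorem shortcutMatrix_mul_stepMatrix (hG : G.Connected) (u : V) (v : S) :
    (shortcutMatrix G S * stepMatrix G S) u v = returnMatrix G S u v := by
  have hS : S.Nonempty := ⟨v, v.2⟩
  have hpow := Matrix.pow_apply_nonneg (avoidingMatrix_nonneg (G := G) (S := S))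
  have hsum := hasSum_returnMatrix hG hS u v
  have h1 : ∀ w, shortcutMatrix G S u w * stepMatrix G S w v =
      ∑' j : ℕ, (avoidingMatrix G S ^ j) u w * walkMatrix G w v := by
    intro w
    simp only [shortcutMatrix, Matrix.of_apply, walkProb_eq]
    rw [← tsum_mul_right]
    refine tsum_congr fun j => ?_
    rw [mul_assoc, walkMatrix_sum_mul_stepMatrix G S w v v.2]
  have hnn : ∀ (j : ℕ) (w : V), 0 ≤ (avoidingMatrix G S ^ j) u w * walkMatrix G w v :=
    fun j w => mul_nonneg (hpow j u w) (walkMatrix_nonneg G w v)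
  rw [Matrix.mul_apply]
  simp only [h1]
  rw [← Summable.tsum_finsetSum, ← hsum.tsum_eq]
  · rfl
  · intro w _
    refine Summable.of_nonneg_of_le (fun j => hnn j w) (fun j => ?_) hsum.summable
    exact Finset.single_le_sum (f := fun w => (avoidingMatrix G S ^ j) u w * walkMatrix G w v)
      (fun w _ => hnn j w) (Finset.mem_univ w)

/-- The factorization of the transition matrix of the Schur complement graph. -/
theorem schurGraph_transition_factorization :
    ∃ C c : ℝ, ∀ n : ℕ, 1 ≤ n →
      ∀ (G : SimpleGraph (Fin n)) [DecidableRel G.Adj], G.Connected →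
      ∀ (S : Finset (Fin n)) (u : S),
        (schurGraph G S).transition u u = 0 ∧
        (∀ v : S, v ≠ u → (schurGraph G S).transition u v =
          rowFactor G S u * (shortcutMatrix G S * stepMatrix G S) u v) ∧
        (2 ≤ S.card → (shortcutMatrix G S * stepMatrix G S) u u < 1 ∧
          rowFactor G S u ≤ C * (n : ℝ) ^ c) := by
  -- The escape bound gives `n ^ 4 + 1`, which is at most `2 * n ^ 4` for `n ≥ 1`.
  refine ⟨2, 4, fun n hn G _ hG S u => ⟨?_, fun v hv => ?_, fun hS => ?_⟩⟩
  · rw [schurGraph_transition_apply hG, if_pos rfl]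
  · rw [schurGraph_transition_apply hG, if_neg hv.symm, rowFactor,
      shortcutMatrix_mul_stepMatrix hG, shortcutMatrix_mul_stepMatrix hG]
    ring
  · rw [rowFactor, shortcutMatrix_mul_stepMatrix hG]
    have h1 := one_le_mul_one_sub_returnMatrix hG hS u
    rw [Fintype.card_fin] at h1
    have h2 : (0 : ℝ) < 1 - returnMatrix G S u u := by
      by_contra h
      have := mul_nonpos_of_nonneg_of_nonpos (by positivity : (0 : ℝ) ≤ (n : ℝ) ^ 4 + 1)
        (not_lt.1 h)
      linarith
    refine ⟨by linarith, ?_⟩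
    rw [div_le_iff₀ h2]
    refine h1.trans (mul_le_mul_of_nonneg_right ?_ h2.le)
    have h3 : (1 : ℝ) ≤ (n : ℝ) ^ 4 := one_le_pow₀ (by exact_mod_cast hn)
    have h4 : (n : ℝ) ^ (4 : ℝ) = (n : ℝ) ^ 4 := by exact_mod_cast Real.rpow_natCast (n : ℝ) 4
    rw [h4]
    linarith

end Shortcut

/-! ### Error analysis of the rounded computation. -/

section Approximation

theorem isLowerApprox_floor {ι κ : Type*} [Fintype κ] {N : ℤ} (hN : 0 < N) {M : Matrix ι κ ℝ}
    (hM : ∀ i j, 0 ≤ M i j) :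
    IsLowerApprox N (Matrix.of fun i j => ⌊(N : ℝ) * M i j⌋) M (Fintype.card κ) where
  nonneg i j := Int.floor_nonneg.2 (mul_nonneg (by exact_mod_cast hN.le) (hM i j))
  le i j := Int.floor_le _
  sum_le i := by
    have h : ∀ j, (N : ℝ) * M i j - (⌊(N : ℝ) * M i j⌋ : ℝ) ≤ 1 := fun j => by
      linarith [Int.lt_floor_add_one ((N : ℝ) * M i j)]
    calc ∑ j, ((N : ℝ) * M i j - (⌊(N : ℝ) * M i j⌋ : ℝ)) ≤ ∑ _j : κ, (1 : ℝ) :=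
          Finset.sum_le_sum fun j _ => h j
      _ = Fintype.card κ := by simp

/-- Removing the diagonal and rescaling each row to the sum `N`, with rounding. -/
def removeDiagonal {ι : Type*} [DecidableEq ι] (N : ℤ) (Y : Matrix ι ι ℤ) : Matrix ι ι ℤ :=
  Matrix.of fun i j => if i = j then 0 else N * Y i j / (N - Y i i)

theorem RowBounded.removeDiagonal {ι : Type*} [Fintype ι] [DecidableEq ι] {N : ℤ} (hN : 0 < N)
    {Y : Matrix ι ι ℤ} (hY : RowBounded N Y) : RowBounded N (removeDiagonal N Y) where
  nonneg i j := by
    simp only [_root_.removeDiagonal, Matrix.of_apply]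
    split_ifs
    · exact le_rfl
    · exact Int.ediv_nonneg (mul_nonneg hN.le (hY.nonneg i j)) (sub_nonneg.2 (hY.le i i))
  sum_le i := by
    -- If the diagonal entry is `N`, the divisor is zero and integer division returns zero; hence no
    -- escape bound is needed for row boundedness.
    rcases (hY.le i i).eq_or_lt with h | h
    · refine le_trans (Finset.sum_nonpos fun j _ => ?_) hN.le
      simp only [_root_.removeDiagonal, Matrix.of_apply]
      split_ifs
      · exact le_rfl
      · rw [h, sub_self, Int.ediv_zero]
    · have hb : 0 < N - Y i i := sub_pos.2 h
      refine le_of_mul_le_mul_right ?_ hb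
      rw [Finset.sum_mul]
      calc ∑ j, _root_.removeDiagonal N Y i j * (N - Y i i)
          ≤ ∑ j, (N * Y i j - if i = j then N * Y i i else 0) := by
            refine Finset.sum_le_sum fun j _ => ?_
            simp only [_root_.removeDiagonal, Matrix.of_apply]
            split_ifs with hij
            · rw [hij]
              simp
            · rw [sub_zero]
              exact Int.ediv_mul_le _ hb.ne'
        _ = N * (∑ j, Y i j - Y i i) := by
            rw [Finset.sum_sub_distrib, Finset.sum_ite_eq, if_pos (Finset.mem_univ i),
              ← Finset.mul_sum]
            ring
        _ ≤ N * (N - Y i i) :=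
            mul_le_mul_of_nonneg_left (sub_le_sub_right (hY.sum_le i) _) hN.le

/-- Underestimating `H i i` enlarges the denominator, so the quotient stays a lower bound. The
errors of numerator and denominator are each amplified by at most `1 / (1 - H i i) ≤ K`, whence `2 *
K * Δ`; the floors add one per entry. -/
theorem IsLowerApprox.removeDiagonal {ι : Type*} [Fintype ι] [DecidableEq ι] {N : ℤ} (hN : 0 < N)
    {Y : Matrix ι ι ℤ} {H : Matrix ι ι ℝ} {Δ K : ℝ} (hY : IsLowerApprox N Y H Δ)
    (hH0 : ∀ i j, 0 ≤ H i j) (hH : ∀ i, ∑ j, H i j ≤ 1) (hK0 : 0 ≤ K)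
    (hK : ∀ i, 1 ≤ K * (1 - H i i)) :
    IsLowerApprox N (removeDiagonal N Y)
      (Matrix.of fun i j => if i = j then 0 else H i j / (1 - H i i))
      (2 * K * Δ + Fintype.card ι) := by
  have hN' : (0 : ℝ) < N := by exact_mod_cast hN
  have ha : ∀ i, 0 < 1 - H i i := by
    intro i
    by_contra h
    have := mul_nonpos_of_nonneg_of_nonpos hK0 (not_lt.1 h)
    linarith [hK i]
  have hb : ∀ i, (N : ℝ) * (1 - H i i) ≤ N - Y i i := fun i => by linarith [hY.le i i]
  have hb0 : ∀ i, (0 : ℝ) < N - Y i i := fun i => (mul_pos hN' (ha i)).trans_le (hb i)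
  have hb1 : ∀ i, 0 < N - Y i i := fun i => by exact_mod_cast hb0 i
  have hY0 : ∀ i j, (0 : ℝ) ≤ Y i j := fun i j => by exact_mod_cast hY.nonneg i j
  refine ⟨((hY.rowBounded hN hH).removeDiagonal hN).nonneg, fun i j => ?_, fun i => ?_⟩
  · simp only [_root_.removeDiagonal, Matrix.of_apply]
    split_ifs
    · simp
    · refine (Int.cast_ediv_le _ _ (hb1 i)).trans ?_
      push_cast
      rw [mul_div_assoc]
      refine mul_le_mul_of_nonneg_left ?_ hN'.le
      rw [div_le_div_iff₀ (hb0 i) (ha i)]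
      calc Y i j * (1 - H i i) ≤ (N * H i j) * (1 - H i i) :=
            mul_le_mul_of_nonneg_right (hY.le i j) (ha i).le
        _ = H i j * (N * (1 - H i i)) := by ring
        _ ≤ _ := mul_le_mul_of_nonneg_left (hb i) (hH0 i j)
  · set a := 1 - H i i with haa
    set b : ℝ := (N : ℝ) - Y i i with hbb
    set d : ℝ := N * H i i - Y i i with hd
    have hd0 : 0 ≤ d := sub_nonneg.2 (hY.le i i)
    have hterm : ∀ j, (N : ℝ) * (Matrix.of fun i j => if i = j then 0 else H i j / (1 - H i i)) i j
        - (_root_.removeDiagonal N Y i j : ℝ) ≤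
        (N * H i j - Y i j) / a + (Y i j - if i = j then (Y i i : ℝ) else 0) / b * (d / a) + 1 := by
      intro j
      by_cases hij : i = j
      · subst hij
        simp only [_root_.removeDiagonal, Matrix.of_apply, if_true, Int.cast_zero, mul_zero,
          sub_self, zero_div, zero_mul]
        have := div_nonneg hd0 (ha i).le
        linarith
      · simp only [_root_.removeDiagonal, Matrix.of_apply, if_neg hij, sub_zero]
        have h1 := Int.div_sub_one_le_cast_ediv (N * Y i j) (N - Y i i) (hb1 i)
        push_cast at h1
        rw [← hbb] at h1
        rw [← haa]
        have h2 : N * (H i j / a) - N * Y i j / b =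
            (N * H i j - Y i j) / a + Y i j / b * (d / a) := by
          have h3 := (ha i).ne'
          have h4 := (hb0 i).ne'
          rw [← haa] at h3
          rw [← hbb] at h4
          have h5 : d = b - N * a := by rw [hd, hbb, haa]; ring
          rw [h5]
          field_simp
          ring
        linarith
    refine (Finset.sum_le_sum fun j _ => hterm j).trans ?_
    rw [Finset.sum_add_distrib, Finset.sum_add_distrib, ← Finset.sum_div, ← Finset.sum_mul,
      ← Finset.sum_div, Finset.sum_sub_distrib (f := fun j => (Y i j : ℝ)), Finset.sum_ite_eq,
      if_pos (Finset.mem_univ i), Finset.sum_const, Finset.card_univ, nsmul_eq_mul, mul_one]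
    have h1 : (∑ j, (Y i j : ℝ) - Y i i) / b ≤ 1 := by
      rw [div_le_one (hb0 i)]
      linarith [hY.sum_cast_le hN hH i]
    have h2 : d ≤ Δ := by
      refine le_trans ?_ (hY.sum_le i)
      exact Finset.single_le_sum (f := fun j => N * H i j - (Y i j : ℝ))
        (fun j _ => sub_nonneg.2 (hY.le i j)) (Finset.mem_univ i)
    have h3 : ∀ z, 0 ≤ z → z ≤ Δ → z / a ≤ K * Δ := by
      intro z hz hzΔ
      rw [div_le_iff₀ (ha i)]
      nlinarith [hK i, mul_le_mul_of_nonneg_right (hK i) hz, mul_nonneg hK0 (ha i).le]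
    have h4 := h3 _ (Finset.sum_nonneg fun j _ => sub_nonneg.2 (hY.le i j)) (hY.sum_le i)
    have h5 := h3 d hd0 h2
    have h6 := mul_le_mul_of_nonneg_right h1 (div_nonneg hd0 (ha i).le)
    linarith

/-- The machines square full `n × n` matrices. Zero rows outside `S` suffice for this to square the
`S × S` block, even if the columns outside `S` contain other numbers. -/
theorem roundMul_submatrix_of_rows_zero {V : Type*} [Fintype V] [DecidableEq V] {S : Finset V}
    (N : ℤ) {Z : Matrix V V ℤ} (hZ : ∀ x, x ∉ S → ∀ y, Z x y = 0) (t : ℕ) :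
    ((fun Z => roundMul N Z Z)^[t] Z).submatrix (Subtype.val : S → V) (Subtype.val : S → V) =
      (fun Z => roundMul N Z Z)^[t] (Z.submatrix Subtype.val Subtype.val) := by
  induction t generalizing Z with
  | zero => rfl
  | succ t ih =>
    rw [Function.iterate_succ_apply, Function.iterate_succ_apply, ih]
    · congr 1
      ext u v
      simp only [roundMul, Matrix.submatrix_apply, Matrix.of_apply, Matrix.mul_apply]
      congr 1
      rw [Finset.univ_eq_attach, Finset.sum_attach S (fun y => Z u y * Z y v)]
      refine (Finset.sum_subset (Finset.subset_univ S) fun y _ hy => ?_).symm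
      rw [hZ y hy, mul_zero]
    · intro x hx y
      simp [roundMul, Matrix.mul_apply, hZ x hx]

variable {V : Type*} [Fintype V] [DecidableEq V] {G : SimpleGraph V} [DecidableRel G.Adj]
  {S : Finset V}

theorem absorbedMatrix_nonneg (x y : V) : 0 ≤ absorbedMatrix G S x y := by
  simp only [absorbedMatrix, Matrix.of_apply]
  split_ifs
  exacts [zero_le_one, le_rfl, walkMatrix_nonneg G x y]

theorem absorbedMatrix_sum_le_one (x : V) : ∑ y, absorbedMatrix G S x y ≤ 1 := by
  by_cases hx : x ∈ S
  · simp [absorbedMatrix, hx]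
  · simpa [absorbedMatrix, hx] using walkMatrix_sum_le_one G x

theorem absorbedMatrix_pow_mul_harmonicMatrix (hG : G.Connected) (hS : S.Nonempty) (m : ℕ) :
    absorbedMatrix G S ^ m * harmonicMatrix G S = harmonicMatrix G S := by
  have h1 : absorbedMatrix G S * harmonicMatrix G S = harmonicMatrix G S := by
    ext x v
    by_cases hx : x ∈ S
    · simp [Matrix.mul_apply, absorbedMatrix, hx]
    · rw [harmonicMatrix_eq_returnMatrix hG hS hx]
      simp [Matrix.mul_apply, absorbedMatrix, hx, returnMatrix]
  induction m with
  | zero => rw [pow_zero, Matrix.one_mul]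
  | succ m ih => rw [pow_succ, Matrix.mul_assoc, h1, ih]

/-- The powers of the absorbed walk converge to the harmonic matrix from below. -/
theorem harmonicMatrix_sub_absorbedMatrix_pow (hG : G.Connected) (hS : S.Nonempty) {m : ℕ}
    (hm : 0 < m) :
    (∀ x (v : S), (absorbedMatrix G S ^ m) x v ≤ harmonicMatrix G S x v) ∧
    ∀ x, ∑ v : S, (harmonicMatrix G S x v - (absorbedMatrix G S ^ m) x v) ≤
      (Fintype.card V : ℝ) ^ 4 / m := by
  have hpow := Matrix.pow_apply_nonneg (absorbedMatrix_nonneg (G := G) (S := S)) m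
  -- What is missing after `m` steps is the mass still outside `S` that will later be absorbed in
  -- `v`. Summed over `v`, it is the probability of not being absorbed yet, which the hitting time
  -- bounds.
  have h1 : ∀ x (v : S), harmonicMatrix G S x v - (absorbedMatrix G S ^ m) x v =
      ∑ y, (absorbedMatrix G S ^ m) x y * if y ∈ S then 0 else harmonicMatrix G S y v := by
    intro x v
    have h2 := congrFun (congrFun (absorbedMatrix_pow_mul_harmonicMatrix hG hS m) x) v
    have h3 : (absorbedMatrix G S ^ m) x v =
        ∑ y, (absorbedMatrix G S ^ m) x y * if y = v then 1 else 0 := by simp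
    conv_lhs => rw [← h2, h3, Matrix.mul_apply, ← Finset.sum_sub_distrib]
    refine Finset.sum_congr rfl fun y _ => ?_
    by_cases hy : y ∈ S
    · rw [harmonicMatrix_of_mem hy, if_pos hy, sub_self, mul_zero]
    · rw [if_neg hy, if_neg (fun e : y = v => hy (e ▸ v.2)), mul_zero, sub_zero]
  have h0 : ∀ y (v : S), 0 ≤ if y ∈ S then 0 else harmonicMatrix G S y v := by
    intro y v
    split_ifs
    exacts [le_rfl, harmonicMatrix_nonneg y v]
  refine ⟨fun x v => ?_, fun x => ?_⟩
  · rw [← sub_nonneg, h1]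
    exact Finset.sum_nonneg fun y _ => mul_nonneg (hpow x y) (h0 y v)
  · obtain ⟨h, hin, hh0, hout, hle⟩ := exists_hittingTime hG hS
    let e : V → ℝ := fun y => if y ∈ S then 0 else 1
    have h4 : ∑ v : S, (harmonicMatrix G S x v - (absorbedMatrix G S ^ m) x v) =
        (absorbedMatrix G S ^ m).mulVec e x := by
      simp only [h1]
      rw [Finset.sum_comm]
      refine Finset.sum_congr rfl fun y _ => ?_
      rw [← Finset.mul_sum]
      congr 1
      by_cases hy : y ∈ S
      · simp [e, hy]
      · simp only [e, if_neg hy]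
        exact harmonicMatrix_sum_eq_one hG hS y
    have h5 : ∀ x, (absorbedMatrix G S).mulVec e x ≤ e x := by
      intro x
      by_cases hx : x ∈ S
      · rw [show e x = 0 by simp [e, hx]]
        refine Finset.sum_nonpos fun y _ => le_of_eq ?_
        by_cases hxy : x = y
        · simp [e, ← hxy, hx]
        · simp [absorbedMatrix, hx, hxy]
      · have h6 : e x = 1 := by simp [e, hx]
        rw [h6]
        refine le_trans (Finset.sum_le_sum fun y _ => ?_)
          (absorbedMatrix_sum_le_one (G := G) (S := S) x)
        refine mul_le_of_le_one_right (absorbedMatrix_nonneg x y) ?_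
        simp only [e]
        split_ifs <;> norm_num
    have h7 : (absorbedMatrix G S).mulVec h = h - e := by
      funext x
      by_cases hx : x ∈ S
      · simp [Matrix.mulVec, dotProduct, absorbedMatrix, hx, e]
      · have h8 := hout x hx
        have h9 : (absorbedMatrix G S).mulVec h x = (walkMatrix G).mulVec h x := by
          simp [Matrix.mulVec, dotProduct, absorbedMatrix, hx]
        simp only [h9, Pi.sub_apply, e, if_neg hx]
        linarith
    rw [h4, le_div_iff₀ (by exact_mod_cast hm), mul_comm]
    exact (mul_pow_mulVec_le absorbedMatrix_nonneg h5 h7 hh0 m x).trans (hle x)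

theorem IsLowerApprox.harmonicMatrix {N : ℤ} (hN : 0 < N) (hG : G.Connected) (hS : S.Nonempty)
    {m : ℕ} (hm : 0 < m) {Z : Matrix V V ℤ} {Δ : ℝ}
    (hZ : IsLowerApprox N Z (absorbedMatrix G S ^ m) Δ) :
    IsLowerApprox N (Z.submatrix id (Subtype.val : S → V)) (harmonicMatrix G S)
      (Δ + N * ((Fintype.card V : ℝ) ^ 4 / m)) := by
  have hN' : (0 : ℝ) < N := by exact_mod_cast hN
  obtain ⟨h1, h2⟩ := harmonicMatrix_sub_absorbedMatrix_pow hG hS hm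
  refine ⟨fun x v => hZ.nonneg x v, fun x v =>
    (hZ.le x v).trans (mul_le_mul_of_nonneg_left (h1 x v) hN'.le), fun x => ?_⟩
  have h3 : ∑ v : S, ((N : ℝ) * (absorbedMatrix G S ^ m) x v - Z x v) ≤ Δ := by
    refine le_trans ?_ (hZ.sum_le x)
    rw [← Finset.sum_mem_add_sum_notMem S]
    exact le_add_of_nonneg_right (Finset.sum_nonneg fun y _ => sub_nonneg.2 (hZ.le x y))
  have h4 := mul_le_mul_of_nonneg_left (h2 x) hN'.le
  rw [Finset.mul_sum] at h4
  refine le_trans (le_of_eq ?_) (add_le_add h3 h4)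
  rw [← Finset.sum_add_distrib]
  refine Finset.sum_congr rfl fun v _ => ?_
  simp only [Matrix.submatrix_apply, id]
  ring

/-- From the rounded walk matrix to the rounded powers of the transition matrix of the Schur
complement graph. -/
theorem isLowerApprox_schurGraph_transition_pow {N : ℤ} (hN : 0 < N) (hG : G.Connected)
    (hS : S.Nonempty) (s t : ℕ) {P A Z : Matrix V V ℤ} {n : ℝ} (hn : n = Fintype.card V)
    (hP : IsLowerApprox N P (walkMatrix G) n) (hA : IsLowerApprox N A (absorbedMatrix G S) n)
    (hZ : ∀ x y, Z x y = if x ∈ S then removeDiagonal N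
      (roundMul N P ((fun Z => roundMul N Z Z)^[s] A)) x y else 0) :
    IsLowerApprox N (((fun Z => roundMul N Z Z)^[t] Z).submatrix (Subtype.val : S → V)
      (Subtype.val : S → V)) ((schurGraph G S).transition ^ 2 ^ t)
      (2 ^ t * (2 * (n ^ 4 + 1) * (2 * n + 2 ^ s * (2 * n) + N * (n ^ 4 / 2 ^ s)) + 2 * n)) := by
  have hN' : (0 : ℝ) < N := by exact_mod_cast hN
  have hn0 : 0 ≤ n := hn ▸ Nat.cast_nonneg _
  have hcard : (Fintype.card S : ℝ) ≤ n := by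
    rw [hn]
    exact_mod_cast Fintype.card_le_of_injective _ Subtype.val_injective
  have h1 := hA.iterate_roundMul hN absorbedMatrix_nonneg absorbedMatrix_sum_le_one hn0 s
  have h2 := h1.harmonicMatrix hN hG hS (by positivity)
  rw [← hn] at h2
  push_cast at h2
  have h3 := hP.roundMul hN h2 (walkMatrix_sum_le_one G)
    (fun x => (harmonicMatrix_sum_eq_one hG hS x).le) (by positivity)
  -- The error of `Y` is `n` from `P`, `2 ^ s * (2 * n)` from rounding in the squarings, `N * n ^ 4
  -- / 2 ^ s` from stopping the walk, and at most `n` from the last rounding.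
  set Y := roundMul N P ((fun Z => roundMul N Z Z)^[s] A) with hY
  have h4 : IsLowerApprox N (Y.submatrix (Subtype.val : S → V) (Subtype.val : S → V))
      ((returnMatrix G S).submatrix (Subtype.val : S → V) id)
      (2 * n + 2 ^ s * (2 * n) + N * (n ^ 4 / 2 ^ s)) :=
    ⟨fun u v => h3.nonneg u v, fun u v => h3.le u v, fun u => (h3.sum_le u).trans (by linarith)⟩
  have hT0 : ∀ u v, 0 ≤ (schurGraph G S).transition u v := fun u v =>
    div_nonneg ((schurGraph G S).nonneg u v)
      (Finset.sum_nonneg fun x _ => (schurGraph G S).nonneg u x)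
  have hT1 : ∀ u, ∑ v, (schurGraph G S).transition u v ≤ 1 := by
    intro u
    simp only [SimpleWeightedGraph.transition, Matrix.of_apply]
    rw [← Finset.sum_div]
    exact div_self_le_one _
  have h5 : IsLowerApprox N (Z.submatrix (Subtype.val : S → V) (Subtype.val : S → V))
      (schurGraph G S).transition
      (2 * (n ^ 4 + 1) * (2 * n + 2 ^ s * (2 * n) + N * (n ^ 4 / 2 ^ s)) + n) := by
    have hZ' : Z.submatrix (Subtype.val : S → V) (Subtype.val : S → V) =
        removeDiagonal N (Y.submatrix (Subtype.val : S → V) (Subtype.val : S → V)) := by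
      ext u v
      rw [Matrix.submatrix_apply, hZ, if_pos u.2]
      simp only [removeDiagonal, Matrix.of_apply, Matrix.submatrix_apply, Subtype.val_inj]
    have hT : (schurGraph G S).transition = Matrix.of fun u v => if u = v then 0 else
        (returnMatrix G S).submatrix (Subtype.val : S → V) id u v /
          (1 - (returnMatrix G S).submatrix (Subtype.val : S → V) id u u) := by
      ext u v
      exact schurGraph_transition_apply hG u v
    -- For a single vertex no escape bound is available, but both matrices consist of a zero
    -- diagonal entry.
    rcases Nat.lt_or_ge S.card 2 with hc | hc
    · have huv : ∀ u v : S, u = v := fun u v =>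
        Subtype.ext (Finset.card_le_one.1 (Nat.le_of_lt_succ hc) u.1 u.2 v.1 v.2)
      rw [hZ', hT]
      refine ⟨fun u v => ?_, fun u v => ?_, fun u => ?_⟩
      · simp [removeDiagonal, huv u v]
      · simp [removeDiagonal, huv u v]
      · refine le_trans (Finset.sum_nonpos fun v _ => ?_) (by positivity)
        simp [removeDiagonal, huv u v]
    · rw [hZ', hT]
      refine (h4.removeDiagonal hN (fun u v => returnMatrix_nonneg _ v)
        (fun u => returnMatrix_sum_le_one hG hS u) (by positivity) fun u => ?_).mono
        (add_le_add_right hcard _)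
      rw [hn]
      exact one_le_mul_one_sub_returnMatrix hG hc u
  rw [roundMul_submatrix_of_rows_zero N (fun x hx y => by rw [hZ, if_neg hx])]
  refine (h5.iterate_roundMul hN hT0 hT1 (by positivity) t).mono ?_
  refine mul_le_mul_of_nonneg_left ?_ (by positivity)
  linarith

end Approximation

/-! ### The Congested Clique algorithm. -/

section Algorithm

namespace LocalInput

variable {n : ℕ} (I : LocalInput n)

open Classical in
/-- The row of the walk matrix that a machine computes from its local input. -/
noncomputable def walkRow (j : Fin n) : ℝ :=
  if j ∈ I.neighbors then 1 / (I.neighbors.ncard : ℝ) else 0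

open Classical in
/-- The row of the absorbed walk matrix that machine `i` computes from its local input. -/
noncomputable def absorbedRow (i j : Fin n) : ℝ :=
  if I.marked then (if i = j then 1 else 0) else I.walkRow j

theorem walkRow_nonneg (j : Fin n) : 0 ≤ I.walkRow j := by
  unfold walkRow
  split_ifs <;> positivity

theorem absorbedRow_nonneg (i j : Fin n) : 0 ≤ I.absorbedRow i j := by
  unfold absorbedRow
  split_ifs
  exacts [zero_le_one, le_rfl, I.walkRow_nonneg j]

theorem sum_walkRow_le_one : ∑ j, I.walkRow j ≤ 1 := by
  classical
  simp only [walkRow]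
  rw [← Finset.sum_filter, Finset.sum_const, nsmul_eq_mul, Set.ncard_eq_toFinset_card',
    show Finset.univ.filter (· ∈ I.neighbors) = I.neighbors.toFinset by ext; simp,
    mul_one_div]
  exact div_self_le_one _

theorem sum_absorbedRow_le_one (i : Fin n) : ∑ j, I.absorbedRow i j ≤ 1 := by
  unfold absorbedRow
  split_ifs
  · simp
  · exact I.sum_walkRow_le_one

theorem walkRow_localInput (G : SimpleGraph (Fin n)) [DecidableRel G.Adj] (S : Finset (Fin n))
    (i j : Fin n) : (localInput G S i).walkRow j = walkMatrix G i j := by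
  have h : (G.neighborSet i).ncard = G.degree i := by
    rw [Set.ncard_eq_toFinset_card', ← SimpleGraph.card_neighborFinset_eq_degree]
    rfl
  simp [walkRow, localInput, walkMatrix, h]

theorem absorbedRow_localInput (G : SimpleGraph (Fin n)) [DecidableRel G.Adj]
    (S : Finset (Fin n)) (i j : Fin n) :
    (localInput G S i).absorbedRow i j = absorbedMatrix G S i j := by
  have h : (localInput G S i).marked ↔ i ∈ S := Iff.rfl
  simp only [absorbedRow, walkRow_localInput, absorbedMatrix, Matrix.of_apply, h]

end LocalInput

variable {n B R : ℕ}

/-- The rounded walk matrix of the graph described by the local inputs. -/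
noncomputable def roundedWalk (N : ℤ) (x : Fin n → LocalInput n) : Matrix (Fin n) (Fin n) ℤ :=
  Matrix.of fun i j => ⌊(N : ℝ) * (x i).walkRow j⌋

/-- The rounded absorbed walk matrix of the graph described by the local inputs. -/
noncomputable def roundedAbsorbed (N : ℤ) (x : Fin n → LocalInput n) :
    Matrix (Fin n) (Fin n) ℤ :=
  Matrix.of fun i j => ⌊(N : ℝ) * (x i).absorbedRow i j⌋

open Classical in
/-- The rounded transition matrix of the Schur complement graph described by the local inputs. -/
noncomputable def roundedTransition (N : ℤ) (s : ℕ) (x : Fin n → LocalInput n) :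
    Matrix (Fin n) (Fin n) ℤ :=
  Matrix.of fun i j => if (x i).marked then removeDiagonal N (roundMul N (roundedWalk N x)
    ((fun Z => roundMul N Z Z)^[s] (roundedAbsorbed N x))) i j else 0

theorem rowBounded_floor {N : ℤ} (hN : 0 < N) {M : Matrix (Fin n) (Fin n) ℝ}
    (h0 : ∀ i j, 0 ≤ M i j) (h1 : ∀ i, ∑ j, M i j ≤ 1) :
    RowBounded N (Matrix.of fun i j => ⌊(N : ℝ) * M i j⌋) :=
  (isLowerApprox_floor hN h0).rowBounded hN h1

theorem rowBounded_roundedWalk {N : ℤ} (hN : 0 < N) (x : Fin n → LocalInput n) :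
    RowBounded N (roundedWalk N x) :=
  rowBounded_floor hN (M := Matrix.of fun i j => (x i).walkRow j)
    (fun i j => (x i).walkRow_nonneg j) (fun i => (x i).sum_walkRow_le_one)

theorem rowBounded_roundedAbsorbed {N : ℤ} (hN : 0 < N) (x : Fin n → LocalInput n) :
    RowBounded N (roundedAbsorbed N x) :=
  rowBounded_floor hN (M := Matrix.of fun i j => (x i).absorbedRow i j)
    (fun i j => (x i).absorbedRow_nonneg i j) (fun i => (x i).sum_absorbedRow_le_one i)

theorem RowBounded.iterate_roundMul {N : ℤ} (hN : 0 < N) {Z : Matrix (Fin n) (Fin n) ℤ}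
    (hZ : RowBounded N Z) (t : ℕ) : RowBounded N ((fun Z => _root_.roundMul N Z Z)^[t] Z) := by
  induction t with
  | zero => exact hZ
  | succ t ih =>
    rw [Function.iterate_succ_apply']
    exact ih.roundMul hN ih

/-- This holds for arbitrary local inputs, not only those of a connected graph, so the algorithm can
be specified on all inputs and correctness is a separate question about its output. -/
theorem rowBounded_roundedTransition {N : ℤ} (hN : 0 < N) (s : ℕ) (x : Fin n → LocalInput n) :
    RowBounded N (roundedTransition N s x) := by
  have h := ((rowBounded_roundedWalk hN x).roundMul hN
    ((rowBounded_roundedAbsorbed hN x).iterate_roundMul hN s)).removeDiagonal hN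
  refine ⟨fun i j => ?_, fun i => ?_⟩
  · simp only [roundedTransition, Matrix.of_apply]
    split_ifs
    exacts [h.nonneg i j, le_rfl]
  · simp only [roundedTransition, Matrix.of_apply]
    split_ifs
    · exact h.sum_le i
    · simpa using hN.le

/-- Matrices with bounded row sums can be multiplied with rounding by an algorithm for integer
matrix multiplication. -/
theorem CliqueComputes.roundMul {N : ℤ} {X Y : Type}
    (hmul : CliqueComputes B R
        {x : Fin n → (Fin n → ℤ) × (Fin n → ℤ) | ∀ i j, |(x i).1 j| ≤ N ∧ |(x i).2 j| ≤ N}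
        (fun x i => (Matrix.of (fun i => (x i).1) * Matrix.of (fun i => (x i).2) :
          Matrix (Fin n) (Fin n) ℤ) i))
    (a b : Fin n → X → Fin n → ℤ) (post : Fin n → X → (Fin n → ℤ) → Y) :
    CliqueComputes B R
      {x | RowBounded N (Matrix.of fun i j => a i (x i) j) ∧
        RowBounded N (Matrix.of fun i j => b i (x i) j)}
      (fun x i => post i (x i) fun j => _root_.roundMul N (Matrix.of fun i j => a i (x i) j)
        (Matrix.of fun i j => b i (x i) j) i j) :=
  (hmul.prePost (fun i x => (a i x, b i x)) (fun i x z => post i x fun j => z j / N)).congr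
    (fun _ hx i j => ⟨hx.1.abs_le i j, hx.2.abs_le i j⟩) (fun _ _ => rfl)

/-- The rounds are spent on `s` squarings of the stopped walk, one product with the walk matrix, `t`
squarings of the transition matrix, and one round of transposition. -/
theorem cliqueComputes_roundedTransition_pow {N : ℤ} (hN : 0 < N) (hB : N < 2 ^ B)
    (hmul : CliqueComputes B R
        {x : Fin n → (Fin n → ℤ) × (Fin n → ℤ) | ∀ i j, |(x i).1 j| ≤ N ∧ |(x i).2 j| ≤ N}
        (fun x i => (Matrix.of (fun i => (x i).1) * Matrix.of (fun i => (x i).2) :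
          Matrix (Fin n) (Fin n) ℤ) i)) (s t : ℕ) :
    CliqueComputes B (s * R + (R + (t * R + 1))) Set.univ
      (fun (x : Fin n → LocalInput n) i =>
        ((fun j => ((fun Z => roundMul N Z Z)^[t] (roundedTransition N s x) i j : ℚ) / N,
          fun j => ((fun Z => roundMul N Z Z)^[t] (roundedTransition N s x) j i : ℚ) / N) :
          (Fin n → ℚ) × (Fin n → ℚ))) := by
  classical
  -- The local input is carried along with the current row because the later product with the walk
  -- matrix needs it again.
  let D : Set (Fin n → LocalInput n × (Fin n → ℤ)) :=
    {x | RowBounded N (Matrix.of fun i j => (x i).2 j)}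
  let sq : (Fin n → LocalInput n × (Fin n → ℤ)) → Fin n → LocalInput n × (Fin n → ℤ) :=
    fun x i => ((x i).1, fun j => roundMul N (Matrix.of fun i j => (x i).2 j)
      (Matrix.of fun i j => (x i).2 j) i j)
  have hsq : CliqueComputes B R D sq := by
    have h := CliqueComputes.roundMul hmul (fun _ (x : LocalInput n × (Fin n → ℤ)) => x.2)
      (fun _ x => x.2) (fun _ x z => (x.1, z))
    exact h.congr (fun x hx => ⟨hx, hx⟩) (fun _ _ => rfl)
  have hsqD : Set.MapsTo sq D D := fun x hx => hx.roundMul hN hx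
  have hit : ∀ (t : ℕ) (x : Fin n → LocalInput n) (Z : Matrix (Fin n) (Fin n) ℤ),
      sq^[t] (fun i => (x i, Z i)) = fun i => (x i, (fun Z => roundMul N Z Z)^[t] Z i) := by
    intro t x
    induction t with
    | zero => intro Z; rfl
    | succ t ih =>
      intro Z
      rw [Function.iterate_succ_apply, Function.iterate_succ_apply, ← ih]
      rfl
  let f₀ : (Fin n → LocalInput n) → Fin n → LocalInput n × (Fin n → ℤ) :=
    fun x i => (x i, roundedAbsorbed N x i)
  have h0 : CliqueComputes B 0 Set.univ f₀ :=
    (CliqueComputes.localMap fun i (x : LocalInput n) =>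
      (x, fun j => ⌊(N : ℝ) * x.absorbedRow i j⌋)).congr (Set.subset_univ _) (fun _ _ => rfl)
  let f₂ : (Fin n → LocalInput n × (Fin n → ℤ)) → Fin n → LocalInput n × (Fin n → ℤ) :=
    fun x i => ((x i).1, fun j => if (x i).1.marked then removeDiagonal N
      (roundMul N (roundedWalk N fun i => (x i).1) (Matrix.of fun i j => (x i).2 j)) i j else 0)
  have h2 : CliqueComputes B R D f₂ := by
    have h := CliqueComputes.roundMul hmul
      (fun _ (x : LocalInput n × (Fin n → ℤ)) j => ⌊(N : ℝ) * x.1.walkRow j⌋) (fun _ x => x.2)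
      -- Machine `i` holds its own diagonal entry `z i`, so the rescaling needs no communication.
      (fun i x z => (x.1, fun j => if x.1.marked then
        (if i = j then 0 else N * z j / (N - z i)) else 0))
    exact h.congr (fun x hx => ⟨rowBounded_roundedWalk hN fun i => (x i).1, hx⟩) (fun _ _ => rfl)
  have h3 : CliqueComputes B 1 {x : Fin n → LocalInput n × (Fin n → ℤ) | ∀ i j,
      0 ≤ (x i).2 j ∧ (x i).2 j ≤ N} (fun x i =>
        ((fun j => ((x i).2 j : ℚ) / N, fun j => ((x j).2 i : ℚ) / N) :
          (Fin n → ℚ) × (Fin n → ℚ))) :=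
    ((CliqueComputes.transpose N hB).prePost (fun _ (x : LocalInput n × (Fin n → ℤ)) => x.2)
      (fun _ _ z => ((fun j => (z.1 j : ℚ) / N, fun j => (z.2 j : ℚ) / N) :
        (Fin n → ℚ) × (Fin n → ℚ)))).congr (fun _ hx => hx) (fun _ _ => rfl)
  have hs : ∀ x, sq^[s] (f₀ x) =
      fun i => (x i, (fun Z => roundMul N Z Z)^[s] (roundedAbsorbed N x) i) := fun x => hit s x _
  have hf₂ : ∀ x, f₂ (sq^[s] (f₀ x)) = fun i => (x i, roundedTransition N s x i) := by
    intro x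
    rw [hs]
    rfl
  have h4 := (((hsq.iterate hsqD s).comp h0 (E := D)
    (fun x _ => rowBounded_roundedAbsorbed hN x)))
  have h5 := h2.comp h4 (fun x _ => by
    rw [hs]
    exact (rowBounded_roundedAbsorbed hN x).iterate_roundMul hN s)
  have h6 := (hsq.iterate hsqD t).comp h5 (fun x _ => by
    rw [hf₂]
    exact rowBounded_roundedTransition hN s x)
  have h7 := h3.comp h6 (fun x _ => by
    rw [hf₂, hit]
    have h8 := (rowBounded_roundedTransition hN s x).iterate_roundMul hN t
    exact fun i j => ⟨h8.nonneg i j, h8.le i j⟩)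
  have hR : 0 + s * R + R + t * R + 1 = s * R + (R + (t * R + 1)) := by ring
  rw [hR] at h7
  refine h7.congr subset_rfl fun x _ => ?_
  rw [hf₂, hit]

theorem cliqueComputesSchurPow_of_error_le {N : ℤ} (hN : 0 < N) (hB : N < 2 ^ B)
    (hmul : CliqueComputes B R
        {x : Fin n → (Fin n → ℤ) × (Fin n → ℤ) | ∀ i j, |(x i).1 j| ≤ N ∧ |(x i).2 j| ≤ N}
        (fun x i => (Matrix.of (fun i => (x i).1) * Matrix.of (fun i => (x i).2) :
          Matrix (Fin n) (Fin n) ℤ) i)) (s t : ℕ) {β : ℝ}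
    (hβ : 2 ^ t * (2 * ((n : ℝ) ^ 4 + 1) * (2 * n + 2 ^ s * (2 * n) + N * ((n : ℝ) ^ 4 / 2 ^ s)) +
      2 * n) ≤ N * β) :
    CliqueComputesSchurPow n B (s * R + (R + (t * R + 1))) (2 ^ t) β := by
  obtain ⟨A, hA⟩ := cliqueComputes_roundedTransition_pow hN hB hmul s t
  refine ⟨A, fun G _ hG S => ?_⟩
  rw [hA _ (Set.mem_univ _)]
  rcases S.eq_empty_or_nonempty with rfl | hS
  · exact ⟨0, fun u => absurd u.2 (Finset.notMem_empty _),
      fun u => absurd u.2 (Finset.notMem_empty _)⟩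
  have hN' : (0 : ℝ) < N := by exact_mod_cast hN
  have hP : IsLowerApprox N (roundedWalk N (localInput G S)) (walkMatrix G) n := by
    have h := isLowerApprox_floor hN (walkMatrix_nonneg G)
    rw [Fintype.card_fin] at h
    convert h using 1
    ext i j
    simp only [roundedWalk, Matrix.of_apply, LocalInput.walkRow_localInput]
  have hA : IsLowerApprox N (roundedAbsorbed N (localInput G S)) (absorbedMatrix G S) n := by
    have h := isLowerApprox_floor hN (absorbedMatrix_nonneg (G := G) (S := S))
    rw [Fintype.card_fin] at h
    convert h using 1
    ext i j
    simp only [roundedAbsorbed, Matrix.of_apply, LocalInput.absorbedRow_localInput]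
  have h := isLowerApprox_schurGraph_transition_pow hN hG hS s t
    (Z := roundedTransition N s (localInput G S)) (by rw [Fintype.card_fin]) hP hA
    (fun x y => by
      have h : (localInput G S x).marked ↔ x ∈ S := Iff.rfl
      simp only [roundedTransition, Matrix.of_apply, h])
  refine ⟨Matrix.of fun u v => ((fun Z => roundMul N Z Z)^[t]
    (roundedTransition N s (localInput G S)) u v : ℚ) / N, fun u v => ?_, fun u v => ⟨rfl, rfl⟩⟩
  have h1 := h.le u v
  -- All errors in a row are nonnegative, so the bound on their sum bounds each entry.
  have h2 := (Finset.single_le_sum (fun v _ => sub_nonneg.2 (h.le u v)) (Finset.mem_univ v)).trans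
    ((h.sum_le u).trans hβ)
  simp only [Matrix.submatrix_apply] at h1 h2
  simp only [Matrix.of_apply]
  push_cast
  rw [div_le_iff₀ hN', le_div_iff₀ hN']
  constructor <;> linarith

/-- The case `n = 1` is separate because powers of `n` absorb constants only for `n ≥ 2`. Here the
transition matrix is zero. -/
theorem cliqueComputesSchurPow_one (B t : ℕ) {β : ℝ} (hβ : 0 ≤ β) :
    CliqueComputesSchurPow 1 B 0 (2 ^ t) β := by
  obtain ⟨A, hA⟩ := CliqueComputes.localMap (n := 1) (B := B) fun _ (_ : LocalInput 1) =>
    ((fun _ => 0, fun _ => 0) : (Fin 1 → ℚ) × (Fin 1 → ℚ))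
  refine ⟨A, fun G _ hG S => ?_⟩
  rw [hA _ (Set.mem_univ _)]
  have hT : (schurGraph G S).transition = 0 := by
    ext u v
    rw [schurGraph_transition_apply hG, if_pos (Subsingleton.elim u v)]
    rfl
  refine ⟨0, fun u v => ?_, fun u v => ⟨rfl, rfl⟩⟩
  rw [hT, zero_pow (by positivity)]
  simpa using hβ

end Algorithm

/-! ### Choice of parameters and round count. -/

section Parameters

theorem exists_mul_rpow_le_pow (D r : ℝ) :
    ∃ a : ℕ, ∀ n : ℕ, 2 ≤ n → D * (n : ℝ) ^ r ≤ (n : ℝ) ^ a := by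
  obtain ⟨d, hd⟩ := pow_unbounded_of_one_lt D (one_lt_two (α := ℝ))
  refine ⟨d + ⌈r⌉₊, fun n hn => ?_⟩
  have hn' : (2 : ℝ) ≤ n := by exact_mod_cast hn
  rw [pow_add]
  refine mul_le_mul (hd.le.trans (pow_le_pow_left₀ zero_le_two hn' d)) ?_ (by positivity)
    (by positivity)
  rw [← Real.rpow_natCast]
  exact Real.rpow_le_rpow_of_exponent_le (by linarith) (Nat.le_ceil r)

/-- The roles are `x = n`, `k = 2 ^ t`, `m = 2 ^ s`, `N = x ^ c`, with `x ^ a` at least the inverse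
of the tolerance. The truncation term scales with `N`, so `m ≥ x ^ p` must beat it for every `c`;
the rounding terms do not, so `c` is chosen after `p`. With `p = g + a + 12` both main terms become
`x ^ (c - 2)`, and the total of at most `4 * x ^ (c - 2)` fits. -/
theorem error_bound (a g p c : ℕ) (hp : p = g + a + 12) (hc : c = 2 * p + g + a + 11)
    {x k m : ℝ} (hx : 2 ≤ x) (hk : k ≤ x ^ g) (hm : x ^ p ≤ m) (hm' : m ≤ x ^ (2 * p)) :
    k * (2 * (x ^ 4 + 1) * (2 * x + m * (2 * x) + x ^ c * (x ^ 4 / m)) + 2 * x) * x ^ a ≤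
      x ^ c := by
  have hx1 : (1 : ℝ) ≤ x := by linarith
  have hx0 : (0 : ℝ) < x := by linarith
  have hm0 : 0 < m := (pow_pos hx0 p).trans_le hm
  have h1 : 2 * (x ^ 4 + 1) ≤ x ^ 6 := by
    have : (1 : ℝ) ≤ x ^ 4 := one_le_pow₀ hx1
    nlinarith [mul_le_mul_of_nonneg_left (by nlinarith : (4 : ℝ) ≤ x ^ 2) (by positivity : 0 ≤ x ^ 4)]
  have h2 : 2 * x ≤ x ^ 2 := by nlinarith
  have h3 : 2 * x + m * (2 * x) ≤ x ^ (2 * p + 3) := by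
    have h4 : (1 : ℝ) ≤ x ^ (2 * p) := one_le_pow₀ hx1
    calc 2 * x + m * (2 * x) = (1 + m) * (2 * x) := by ring
      _ ≤ (2 * x ^ (2 * p)) * x ^ 2 := mul_le_mul (by linarith) h2 (by linarith) (by positivity)
      _ ≤ (x * x ^ (2 * p)) * x ^ 2 := by gcongr
      _ = x ^ (2 * p + 3) := by ring
  have h5 : x ^ c * (x ^ 4 / m) ≤ x ^ (p + g + a + 15) := by
    rw [← mul_div_assoc, div_le_iff₀ hm0]
    calc x ^ c * x ^ 4 = x ^ (p + g + a + 15) * x ^ p := by rw [hc]; ring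
      _ ≤ _ := mul_le_mul_of_nonneg_left hm (by positivity)
  have h6 : x ^ g * x ^ 2 * x ^ a ≤ x ^ (2 * p + g + a + 9) := by
    rw [← pow_add, ← pow_add]
    exact pow_le_pow_right₀ hx1 (by omega)
  calc k * (2 * (x ^ 4 + 1) * (2 * x + m * (2 * x) + x ^ c * (x ^ 4 / m)) + 2 * x) * x ^ a
      ≤ x ^ g * (x ^ 6 * (x ^ (2 * p + 3) + x ^ (p + g + a + 15)) + x ^ 2) * x ^ a := by
        gcongr
    _ = x ^ (2 * p + g + a + 9) + x ^ (p + g + g + a + a + 21) + x ^ g * x ^ 2 * x ^ a := by ring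
    _ = 2 * x ^ (2 * p + g + a + 9) + x ^ g * x ^ 2 * x ^ a := by
        rw [show p + g + g + a + a + 21 = 2 * p + g + a + 9 by omega]
        ring
    _ ≤ 4 * x ^ (2 * p + g + a + 9) := by
        have : 0 < x ^ (2 * p + g + a + 9) := pow_pos hx0 _
        linarith
    _ ≤ x ^ 2 * x ^ (2 * p + g + a + 9) := by
        refine mul_le_mul_of_nonneg_right ?_ (by positivity)
        nlinarith
    _ = x ^ c := by rw [hc]; ring

theorem natLog_add_one_le (n : ℕ) (hn : 1 ≤ n) :
    ((Nat.log 2 n + 1 : ℕ) : ℝ) ≤ 2 * (1 + Real.log n) := by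
  have h1 : (2 : ℝ) ^ Nat.log 2 n ≤ n := by exact_mod_cast Nat.pow_log_le_self 2 (by omega)
  have h2 := Real.log_le_log (by positivity) h1
  rw [Real.log_pow] at h2
  have h3 := Real.log_two_gt_d9
  have h4 : (0 : ℝ) ≤ Nat.log 2 n := Nat.cast_nonneg _
  push_cast
  nlinarith

theorem cliqueComputesSchurPow_of_matMulTime {α : ℝ} (hα : 0 ≤ α) (hmul : CliqueMatMulTime α)
    (c₃ b c₄ K : ℝ) (hb : 0 < b) :
    ∃ (w : ℕ) (C : ℝ) (e : ℕ), ∀ n : ℕ, 1 ≤ n →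
      ∀ β : ℝ, b / (n : ℝ) ^ c₃ ≤ β →
      ∀ k : ℕ, (∃ t : ℕ, k = 2 ^ t) → (k : ℝ) ≤ K * (n : ℝ) ^ c₄ →
        ∃ R : ℕ, (R : ℝ) ≤ C * (n : ℝ) ^ α * (1 + Real.log n) ^ e ∧
          CliqueComputesSchurPow n (messageBits w n) R k β := by
  obtain ⟨a, ha⟩ := exists_mul_rpow_le_pow (1 / b) c₃
  obtain ⟨g, hg⟩ := exists_mul_rpow_le_pow K c₄
  obtain ⟨p, hp⟩ : ∃ p, p = g + a + 12 := ⟨_, rfl⟩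
  obtain ⟨c, hc⟩ : ∃ c, c = 2 * p + g + a + 11 := ⟨_, rfl⟩
  obtain ⟨w, C, hC⟩ := hmul.cliqueComputes c
  -- Width `c + 1` lets one message hold a number up to `n ^ c` in the transposition. The constant
  -- `C` comes from `(p * L + 1 + t) * R + 1` rounds, where `L = Nat.log 2 n + 1`, `t ≤ g * L` and
  -- `L ≤ 2 * (1 + log n)`.
  refine ⟨max w (c + 1), (p + g + 1) * 2 * |C| + 1, 1, ?_⟩
  rintro n hn β hβ k ⟨t, rfl⟩ hk
  have hlog : 0 ≤ Real.log n := Real.log_nonneg (by exact_mod_cast hn)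
  rcases hn.eq_or_lt with rfl | hn2
  · refine ⟨0, ?_, cliqueComputesSchurPow_one _ t (le_trans (by positivity) hβ)⟩
    rw [Nat.cast_zero]
    positivity
  have hn2 : 2 ≤ n := hn2
  obtain ⟨R, hR, hcomp⟩ := hC n hn
  set L := Nat.log 2 n + 1 with hL
  have hx : (2 : ℝ) ≤ n := by exact_mod_cast hn2
  have hx0 : (0 : ℝ) < n := by linarith
  have hnL : n < 2 ^ L := Nat.lt_pow_succ_log_self (by norm_num) n
  have hLn : 2 ^ L ≤ 2 * n := by
    rw [hL, pow_succ, mul_comm]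
    exact Nat.mul_le_mul_left 2 (Nat.pow_log_le_self 2 (by omega))
  have hkg := hk.trans (hg n hn2)
  push_cast at hkg
  have ht : t ≤ g * L := by
    have h1 : 2 ^ t ≤ n ^ g := by exact_mod_cast hkg
    have h2 : 2 ^ t ≤ 2 ^ (g * L) := by
      rw [mul_comm g L, pow_mul]
      exact h1.trans (Nat.pow_le_pow_left hnL.le g)
    exact (Nat.pow_le_pow_iff_right (by norm_num)).1 h2
  have hN : (0 : ℤ) < (n : ℤ) ^ c := by positivity
  have hB : (n : ℤ) ^ c < 2 ^ messageBits (max w (c + 1)) n := by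
    have h1 : n ^ c < 2 ^ messageBits (max w (c + 1)) n := by
      calc n ^ c ≤ (2 ^ L) ^ c := Nat.pow_le_pow_left hnL.le c
        _ = 2 ^ (L * c) := (pow_mul _ _ _).symm
        _ < 2 ^ (max w (c + 1) * L) := by
            refine Nat.pow_lt_pow_right (by norm_num) ?_
            rw [mul_comm L c]
            exact Nat.mul_lt_mul_of_pos_right
              (lt_of_lt_of_le (Nat.lt_succ_self c) (le_max_right _ _)) (Nat.succ_pos _)
    exact_mod_cast h1
  have hmul' := hcomp.mono_bits (B' := messageBits (max w (c + 1)) n)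
    (Nat.mul_le_mul_right _ (le_max_left _ _))
  have hβ' : 1 ≤ β * (n : ℝ) ^ a := by
    have h1 := ha n hn2
    have h2 : 0 < (n : ℝ) ^ c₃ := Real.rpow_pos_of_pos hx0 _
    have h3 : 1 / β ≤ (n : ℝ) ^ c₃ / b := by
      have h4 := one_div_le_one_div_of_le (by positivity) hβ
      rwa [one_div_div] at h4
    have hβ0 : 0 < β := lt_of_lt_of_le (by positivity) hβ
    have h5 : 1 / β ≤ (n : ℝ) ^ a := h3.trans (le_of_eq_of_le (by ring) h1)
    rwa [div_le_iff₀ hβ0, mul_comm] at h5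
  -- With `s = p * L` squarings, `n < 2 ^ L ≤ 2 * n ≤ n ^ 2` places `2 ^ s` between `n ^ p` and `n ^
  -- (2 * p)`.
  have herr := error_bound a g p c hp hc (x := n) (k := 2 ^ t) (m := 2 ^ (p * L)) hx hkg
    (by
      rw [mul_comm p L, pow_mul]
      exact pow_le_pow_left₀ hx0.le (by exact_mod_cast hnL.le) p)
    (by
      rw [mul_comm p L, pow_mul, pow_mul]
      refine pow_le_pow_left₀ (by positivity) ?_ p
      have h1 : (2 : ℝ) ^ L ≤ 2 * n := by exact_mod_cast hLn
      nlinarith)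
  refine ⟨p * L * R + (R + (t * R + 1)), ?_,
    cliqueComputesSchurPow_of_error_le hN hB hmul' (p * L) t ?_⟩
  · have h1 := natLog_add_one_le n hn
    rw [← hL] at h1
    have h2 : (1 : ℝ) ≤ (n : ℝ) ^ α := Real.one_le_rpow (by linarith) hα
    have h3 : (R : ℝ) ≤ |C| * (n : ℝ) ^ α :=
      hR.trans (mul_le_mul_of_nonneg_right (le_abs_self C) (by positivity))
    have h4 : (t : ℝ) ≤ g * L := by exact_mod_cast ht
    have h5 : (1 : ℝ) ≤ L := by exact_mod_cast Nat.succ_pos _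
    push_cast
    rw [pow_one]
    calc (p : ℝ) * L * R + (R + (t * R + 1)) = (p * L + 1 + t) * R + 1 := by ring
      _ ≤ ((p + g + 1) * L) * (|C| * (n : ℝ) ^ α) + 1 := by
          refine add_le_add (mul_le_mul (by linarith) h3 (Nat.cast_nonneg _) (by positivity)) le_rfl
      _ ≤ ((p + g + 1) * (2 * (1 + Real.log n))) * (|C| * (n : ℝ) ^ α) +
            (n : ℝ) ^ α * (1 + Real.log n) := by
          refine add_le_add (mul_le_mul_of_nonneg_right
            (mul_le_mul_of_nonneg_left h1 (by positivity)) (by positivity)) ?_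
          nlinarith
      _ = _ := by ring
  · push_cast
    have h1 : 0 < (n : ℝ) ^ a := pow_pos hx0 a
    refine le_of_mul_le_mul_right (herr.trans ?_) h1
    rw [mul_assoc]
    exact le_mul_of_one_le_right (by positivity) hβ'

end Parameters

theorem mainTheorem9 (α : ℝ) (hα : 0 ≤ α) (hmul : CliqueMatMulTime α) :
    -- the transition matrix of the Schur complement graph, in `Õ(n ^ α)` rounds
    (∀ c₃ b : ℝ, 0 < c₃ → 0 < b → ∃ (w : ℕ) (C : ℝ) (e : ℕ), ∀ n : ℕ, 1 ≤ n →
      ∀ β : ℝ, b / (n : ℝ) ^ c₃ ≤ β →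
        ∃ R : ℕ, (R : ℝ) ≤ C * (n : ℝ) ^ α * (1 + Real.log n) ^ e ∧
          CliqueComputesSchurPow n (messageBits w n) R 1 β) ∧
    -- its powers with exponent `k = O(n ^ c₄)` a power of two
    (∀ c₃ b c₄ K : ℝ, 0 < c₃ → 0 < b → 0 < c₄ → 0 < K →
      ∃ (w : ℕ) (C : ℝ) (e : ℕ), ∀ n : ℕ, 1 ≤ n →
      ∀ β : ℝ, b / (n : ℝ) ^ c₃ ≤ β →
      ∀ k : ℕ, (∃ t : ℕ, k = 2 ^ t) → (k : ℝ) ≤ K * (n : ℝ) ^ c₄ →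
        ∃ R : ℕ, (R : ℝ) ≤ C * (n : ℝ) ^ α * (1 + Real.log n) ^ e ∧
          CliqueComputesSchurPow n (messageBits w n) R k β) ∧
    -- the factorization through the shortcut matrix and the step matrix
    (∃ C c : ℝ, ∀ n : ℕ, 1 ≤ n →
      ∀ (G : SimpleGraph (Fin n)) [DecidableRel G.Adj], G.Connected →
      ∀ (S : Finset (Fin n)) (u : S),
        (schurGraph G S).transition u u = 0 ∧
        (∀ v : S, v ≠ u → (schurGraph G S).transition u v =
          rowFactor G S u * (shortcutMatrix G S * stepMatrix G S) u v) ∧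
        (2 ≤ S.card → (shortcutMatrix G S * stepMatrix G S) u u < 1 ∧
          rowFactor G S u ≤ C * (n : ℝ) ^ c)) := by
  refine ⟨fun c₃ b hc₃ hb => ?_, fun c₃ b c₄ K _ hb _ _ =>
    cliqueComputesSchurPow_of_matMulTime hα hmul c₃ b c₄ K hb,
    schurGraph_transition_factorization⟩
  -- The matrix itself is the power `k = 2 ^ 0`, admissible with `c₄ = K = 1` since `1 ≤ n`.
  obtain ⟨w, C, e, h⟩ := cliqueComputesSchurPow_of_matMulTime hα hmul c₃ b 1 1 hb
  refine ⟨w, C, e, fun n hn β hβ => h n hn β hβ 1 ⟨0, rfl⟩ ?_⟩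
  rw [Real.rpow_one, one_mul]
  exact_mod_cast hn
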